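/- Let $n,d\ge 0$ be integers, $A=(a_{mk})\in\mathbb{R}^{n\times d}$, let $Z_1,\dots,Z_d$ be independent real-valued Lévy processes, and let $T=(T_1,\dots,T_d)$ be a $d$-dimensional subordinator (a Lévy process with values in $\mathbb{R}_+^d$ whose trajectories are non-decreasing in each coordinate), independent of $Z=(Z_1,\dots,Z_d)$. Assume that the moment generating functions of $Z_1(1),\dots,Z_d(1)$ and of $T(1)$ are finite in a neighbourhood of the origin. Put $$Y(t)=A\,\bigl(Z_1(T_1(t)),\dots,Z_d(T_d(t))\bigr)^{\top},\qquad t\ge 0 .$$ For a random vector $X$, let $K_X(z)=\log \mathbf E\,e^{\langle z,X\rangle}$ be its cumulant generating function and let $c_i(X)=\partial_z^{\,i}K_X(0)$ be its joint cumulants ($i$ a multi-index); write $K_{Z_k},K_T,K_Y$ and $c_j(Z_k),c_j(T),c_i(Y)$ for those of $Z_k(1),T(1),Y(1)$. A partition $\Lambda\vdash s$ of a multi-index $s\in\mathbb{N}^n$ is a finite multiset of non-zero multi-indices (the columns of $\Lambda$) with sum $s$. If its distinct columns are $\lambda_1,\lambda_2,\dots$ with multiplicities $r_1,r_2,\dots$,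 put $l(\Lambda)=\sum_j r_j$, $\Lambda!=\prod_j(\lambda_j!)^{r_j}$, $\mathfrak m(\Lambda)!=\prod_j r_j!$ and, for a sequence $(g_\lambda)$ indexed by multi-indices, $g_\Lambda=\prod_j g_{\lambda_j}^{r_j}$. With $g_{k,\lambda}=c_{|\lambda|}(Z_k)\prod_{m=1}^n a_{mk}^{\lambda_m}$, let $$\mathfrak B_i(x_1,\dots,x_d)=i!\sum_{s_1+\cdots+s_d=i}\ \sum_{\Lambda_1\vdash s_1,\dots,\Lambda_d\vdash s_d} x_1^{l(\Lambda_1)}\cdots x_d^{l(\Lambda_d)}\,\frac{g_{1,\Lambda_1}\cdots g_{d,\Lambda_d}}{\Lambda_1!\cdots\Lambda_d!\;\mathfrak m(\Lambda_1)!\cdots\mathfrak m(\Lambda_d)!}$$ be the $i$-th generalized complete exponential Bell polynomial, and let $E$ be the linear functional on $\mathbb{R}[x_1,\dots,x_d]$ with $E(x_1^{j_1}\cdots x_d^{j_d})=c_{j}(T)$ for all $j\in\mathbb{N}^d$. Then: 1. The moment generating function of $Y(1)$ is finite in a neighbourhood of the origin. 2. For every $z\in\mathbb{R}^n$ at which the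 right-hand side is defined (that is, all the moment generating functions occurring in it are finite), the moment generating function of $Y(1)$ is finite at $z$ and $$K_Y(z)=K_T\Bigl(K_{Z_1}\bigl(\textstyle\sum_{m}a_{m1}z_m\bigr),\dots,K_{Z_d}\bigl(\sum_{m}a_{md}z_m\bigr)\Bigr).$$ 3. For every $i\in\mathbb{N}^n$, $c_i(Y)=E\bigl(\mathfrak B_i(x_1,\dots,x_d)\bigr)$; that is, $c_i(Y)$ is obtained from $\mathfrak B_i$ by replacing each monomial $x_1^{j_1}\cdots x_d^{j_d}$ by $c_j(T)$. -/

import Mathlib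

open MeasureTheory ProbabilityTheory Filter
open scoped NNReal Topology Nat

noncomputable section

namespace SubLevy

/-! ### Lévy processes and subordinators -/

/-- An `E`-valued Lévy process `(X t)`, `t ≥ 0`: it starts at `0`, has independent and stationary
increments, is stochastically continuous, and almost all of its paths are right-continuous with
left limits. -/
structure IsLevyProcess {Ω E : Type*} [MeasurableSpace Ω] [NormedAddCommGroup E]
    [MeasurableSpace E] (X : ℝ≥0 → Ω → E) (P : Measure Ω) : Prop where
  measurable : ∀ t, Measurable (X t)
  start_zero : ∀ᵐ ω ∂P, X 0 ω = 0
  indep_increments : HasIndepIncrements X P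
  stationary_increments : ∀ s t, IdentDistrib (X (s + t) - X s) (X t - X 0) P P
  stoch_continuous : ∀ t, TendstoInMeasure P X (𝓝 t) (X t)
  cadlag : ∀ᵐ ω ∂P, ∀ t : ℝ≥0,
    ContinuousWithinAt (fun r => X r ω) (Set.Ici t) t ∧
      ∃ l : E, Tendsto (fun r => X r ω) (𝓝[<] t) (𝓝 l)

/-- A `d`-dimensional subordinator: a Lévy process in `ℝ^d` whose trajectories are increasing in
each coordinate (hence, starting at `0`, they stay in the nonnegative orthant). -/
structure IsSubordinator {Ω : Type*} [MeasurableSpace Ω] {d : ℕ}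
    (T : ℝ≥0 → Ω → (Fin d → ℝ)) (P : Measure Ω) : Prop where
  isLevy : IsLevyProcess T P
  increasing : ∀ᵐ ω ∂P, ∀ k, Monotone (fun t => T t ω k)

/-- The subordinated process `Y(t) = A (Z₁(T₁(t)), …, Z_d(T_d(t)))ᵀ`. The coordinates of a
subordinator are almost surely nonnegative, so `Real.toNNReal` only changes the type. -/
def subordinated {Ω : Type*} {n d : ℕ} (A : Matrix (Fin n) (Fin d) ℝ)
    (Z : Fin d → ℝ≥0 → Ω → ℝ) (T : ℝ≥0 → Ω → (Fin d → ℝ)) :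
    ℝ≥0 → Ω → (Fin n → ℝ) :=
  fun t ω => A.mulVec (fun k => Z k (T t ω k).toNNReal ω)

/-! ### Cumulant generating functions and cumulants -/

/-- The moment generating function of the random vector `X` is finite at `z`. -/
def FiniteMGFAt {Ω : Type*} [MeasurableSpace Ω] {n : ℕ} (X : Ω → (Fin n → ℝ)) (P : Measure Ω)
    (z : Fin n → ℝ) : Prop :=
  Integrable (fun ω => Real.exp (∑ m, z m * X ω m)) P

/-- The joint cumulant generating function `K_X(z) = log E[exp(∑ z_m X_m)]`. -/
def jointCgf {Ω : Type*} [MeasurableSpace Ω] {n : ℕ} (X : Ω → (Fin n → ℝ)) (P : Measure Ω)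
    (z : Fin n → ℝ) : ℝ :=
  Real.log (∫ ω, Real.exp (∑ m, z m * X ω m) ∂P)

/-- The partial derivative of `f` in the `m`-th coordinate. -/
def partialDeriv {n : ℕ} (m : Fin n) (f : (Fin n → ℝ) → ℝ) : (Fin n → ℝ) → ℝ :=
  fun z => lineDeriv ℝ f z (Pi.single m 1)

/-- The mixed partial derivative `∂₁^{i₁} ⋯ ∂ₙ^{iₙ} f`. -/
def mixedPartial {n : ℕ} (i : Fin n →₀ ℕ) (f : (Fin n → ℝ) → ℝ) : (Fin n → ℝ) → ℝ :=
  (List.finRange n).foldr (fun m h => (partialDeriv m)^[i m] h) f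

/-- The joint cumulant `c_i(X)`: the coefficient of `z^i / i!` in the Taylor expansion of `K_X`
at `0`. -/
def jointCumulant {Ω : Type*} [MeasurableSpace Ω] {n : ℕ} (X : Ω → (Fin n → ℝ)) (P : Measure Ω)
    (i : Fin n →₀ ℕ) : ℝ :=
  mixedPartial i (jointCgf X P) 0

/-- The `m`-th cumulant of a real random variable. -/
def cumulant {Ω : Type*} [MeasurableSpace Ω] (X : Ω → ℝ) (P : Measure Ω) (m : ℕ) : ℝ :=
  iteratedDeriv m (cgf X P) 0

/-! ### Multi-index partitions -/

/-- The factorial `i! = i₁! ⋯ iₙ!` of a multi-index. -/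
def multiFactorial {n : ℕ} (i : Fin n →₀ ℕ) : ℕ := ∏ m, (i m)!

/-- A partition of the multi-index `i`: a matrix of nonnegative integers without zero columns,
whose columns are taken up to order (equivalently, in lexicographic order) and sum to `i`. It is
recorded as the multiset of its columns. -/
@[ext] structure MultiPartition {n : ℕ} (i : Fin n →₀ ℕ) where
  cols : Multiset (Fin n →₀ ℕ)
  ne_zero : ∀ c ∈ cols, c ≠ 0
  sum_eq : cols.sum = i

namespace MultiPartition

theorem degree_sum_ge {n : ℕ} (M : Multiset (Fin n →₀ ℕ)) (h : ∀ c ∈ M, c ≠ 0) :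
    M.card ≤ M.sum.degree := by
  induction M using Multiset.induction_on with
  | empty => simp
  | cons a M ih =>
    have h1 := ih (fun c hc => h c (Multiset.mem_cons_of_mem hc))
    have h2 : a.degree ≠ 0 := by
      rw [Ne, Finsupp.degree_eq_zero_iff]
      exact h a (Multiset.mem_cons_self a M)
    rw [Multiset.card_cons, Multiset.sum_cons, map_add]
    omega

instance instFinite {n : ℕ} (i : Fin n →₀ ℕ) : Finite (MultiPartition i) := by
  classical
  let S : Finset (Multiset (Fin n →₀ ℕ)) :=
    (Multiset.powerset (i.degree • (Finset.Iic i).val)).toFinset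
  refine Finite.of_injective
    (fun L : MultiPartition i => (⟨L.cols, ?_⟩ : {M // M ∈ S})) ?_
  · rw [Multiset.mem_toFinset, Multiset.mem_powerset, Multiset.le_iff_count]
    intro c
    by_cases hc : c ∈ L.cols
    · have h1 : c ∈ (Finset.Iic i).val := by
        rw [Finset.mem_val, Finset.mem_Iic, ← L.sum_eq]
        exact Multiset.single_le_sum (fun _ _ => zero_le) c hc
      rw [Multiset.count_nsmul, Multiset.count_eq_one_of_mem (Finset.Iic i).nodup h1, mul_one]
      have h2 := degree_sum_ge L.cols L.ne_zero
      rw [L.sum_eq] at h2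
      exact (Multiset.count_le_card c L.cols).trans h2
    · rw [Multiset.count_eq_zero_of_notMem hc]
      exact Nat.zero_le _
  · intro L L' h
    exact MultiPartition.ext (congrArg Subtype.val h)

instance instFintype {n : ℕ} (i : Fin n →₀ ℕ) : Fintype (MultiPartition i) :=
  Fintype.ofFinite _

variable {n : ℕ} {i : Fin n →₀ ℕ}

/-- The number `l(Λ)` of columns. -/
def length (L : MultiPartition i) : ℕ := L.cols.card

/-- `Λ!`, the product of the factorials of all columns, counted with multiplicity. -/
def factorial (L : MultiPartition i) : ℕ := (L.cols.map multiFactorial).prod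

/-- `𝔪(Λ)!`, the product of the factorials of the multiplicities of the distinct columns. -/
def multFactorial (L : MultiPartition i) : ℕ :=
  ∏ c ∈ L.cols.toFinset, (L.cols.count c)!

/-- The product `g_Λ` associated to the multi-indexed sequence `g` through `Λ`. -/
def assoc (L : MultiPartition i) (g : (Fin n →₀ ℕ) → ℝ) : ℝ := (L.cols.map g).prod

end MultiPartition

/-! ### Generalized Bell polynomials and umbral evaluation -/

/-- The `i`-th generalized complete exponential Bell polynomial in the indeterminates
`x₁, …, x_d`, built from the multi-indexed sequences `g₁, …, g_d`. The sum runs over all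
`s₁ + ⋯ + s_d = i` and all partitions of `s₁, …, s_d`. -/
def bellPolynomial {n d : ℕ} (g : Fin d → (Fin n →₀ ℕ) → ℝ) (i : Fin n →₀ ℕ) :
    MvPolynomial (Fin d) ℝ :=
  MvPolynomial.C (multiFactorial i : ℝ) *
    ∑ s ∈ Finset.piAntidiag (Finset.univ : Finset (Fin d)) i,
      ∑ L : (∀ k, MultiPartition (s k)),
        (∏ k, MvPolynomial.X k ^ (L k).length) *
          MvPolynomial.C ((∏ k, (L k).assoc (g k)) /
            ((∏ k, ((L k).factorial : ℝ)) * ∏ k, ((L k).multFactorial : ℝ)))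

/-- The linear operator on polynomials in `x₁, …, x_d` that sends the monomial
`x₁^{j₁} ⋯ x_d^{j_d}` to the joint cumulant `c_j(T)`. -/
def umbralEval {Ω : Type*} [MeasurableSpace Ω] {d : ℕ} (T : Ω → (Fin d → ℝ)) (P : Measure Ω) :
    MvPolynomial (Fin d) ℝ →ₗ[ℝ] ℝ :=
  (MvPolynomial.basisMonomials (Fin d) ℝ).constr ℝ (fun j => jointCumulant T P j)

/-- The sequences `g_{k,λ} = c_{|λ|}(Z_k) (a_{·k})^λ`, where `a_{·k}` is the `k`-th column
of `A`. -/
def cumulantSeq {Ω : Type*} [MeasurableSpace Ω] {n d : ℕ} (A : Matrix (Fin n) (Fin d) ℝ)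
    (Z : Fin d → Ω → ℝ) (P : Measure Ω) (k : Fin d) (l : Fin n →₀ ℕ) : ℝ :=
  cumulant (Z k) P l.degree * ∏ m, A m k ^ l m

end SubLevy

end

/-! Put `u = Aᵀ z`. Given `T(1) = t`, independence turns the exponential moment of `⟨z, Y(1)⟩` into
`∏ E exp(u_k Z_k(t_k))`. The Lévy property gives `E exp(u Z_k(t)) = exp(t K_{Z_k}(u))` for every
real `t ≥ 0` (`lexpMoment_eq`). Averaging over `T(1)` yields the moment generating function of
`T(1)` at `(K_{Z_k}(u_k))_k`. The computation takes place in `[0, ∞]`, so finiteness and the formula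
for `K_Y` come together (`finiteMGFAt_and_jointCgf_subordinated`). Finiteness near the origin
follows because each `K_{Z_k}` is continuous at `0` and vanishes there.

The cumulants of `Y(1)` are then the derivatives at `0` of `K_T ∘ g`, where `g 0 = 0`. Derivatives
of order at most `N` see only jets of order `N`, so `K_T` and `g` may be replaced by Taylor
polynomials. Extracting a coefficient of the composed polynomial by the multinomial theorem produces
the sum over partitions (`mixedPartial_comp_eq_constr_bellPolynomial`). -/

noncomputable section

namespace SubLevy

/-! ### Mixed partial derivatives and finite-order jets of smooth germs -/

section Jets

open scoped ContDiff

variable {n d : ℕ}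

/-! ### Partial derivatives of smooth germs -/

theorem partialDeriv_eventuallyEq {f g : (Fin n → ℝ) → ℝ} {p : Fin n → ℝ} (h : f =ᶠ[𝓝 p] g)
    (m : Fin n) : partialDeriv m f =ᶠ[𝓝 p] partialDeriv m g := by
  filter_upwards [h.eventuallyEq_nhds] with z hz
  exact hz.lineDeriv_eq

theorem eventually_differentiableAt {E F : Type*} [NormedAddCommGroup E] [NormedSpace ℝ E]
    [NormedAddCommGroup F] [NormedSpace ℝ F] {f : E → F} {p : E}
    (hf : ContDiffAt ℝ ∞ f p) : ∀ᶠ z in 𝓝 p, DifferentiableAt ℝ f z := by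
  have h1 : ContDiffAt ℝ 1 f p := hf.of_le (by exact_mod_cast le_top)
  filter_upwards [h1.eventually (by simp)] with z hz
  exact hz.differentiableAt (by simp)

theorem partialDeriv_eventuallyEq_fderiv {f : (Fin n → ℝ) → ℝ} {p : Fin n → ℝ}
    (hf : ContDiffAt ℝ ∞ f p) (m : Fin n) :
    partialDeriv m f =ᶠ[𝓝 p] fun z => fderiv ℝ f z (Pi.single m 1) := by
  filter_upwards [eventually_differentiableAt hf] with z hz
  exact hz.lineDeriv_eq_fderiv

theorem contDiffAt_partialDeriv {f : (Fin n → ℝ) → ℝ} {p : Fin n → ℝ}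
    (hf : ContDiffAt ℝ ∞ f p) (m : Fin n) : ContDiffAt ℝ ∞ (partialDeriv m f) p := by
  refine ContDiffAt.congr_of_eventuallyEq ?_ (partialDeriv_eventuallyEq_fderiv hf m)
  exact (hf.fderiv_right (m := ∞) (by simp)).clm_apply contDiffAt_const

theorem partialDeriv_comm {f : (Fin n → ℝ) → ℝ} {p : Fin n → ℝ}
    (hf : ContDiffAt ℝ ∞ f p) (m k : Fin n) :
    partialDeriv m (partialDeriv k f) =ᶠ[𝓝 p] partialDeriv k (partialDeriv m f) := by
  have key : ∀ m k : Fin n, partialDeriv m (partialDeriv k f) =ᶠ[𝓝 p]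
      fun z => fderiv ℝ (fderiv ℝ f) z (Pi.single m 1) (Pi.single k 1) := by
    intro m k
    refine (partialDeriv_eventuallyEq (partialDeriv_eventuallyEq_fderiv hf k) m).trans ?_
    have h1 : ContDiffAt ℝ ∞ (fderiv ℝ f) p := hf.fderiv_right (m := ∞) (by simp)
    filter_upwards [eventually_differentiableAt h1] with z hz
    have h2 : HasFDerivAt (fun z => fderiv ℝ f z (Pi.single k 1))
        ((fderiv ℝ (fderiv ℝ f) z).flip (Pi.single k 1)) z := by
      simpa using hz.hasFDerivAt.clm_apply (hasFDerivAt_const (Pi.single k (1 : ℝ)) z)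
    rw [partialDeriv, h2.differentiableAt.lineDeriv_eq_fderiv, h2.fderiv]
    simp
  have h2 : ContDiffAt ℝ 2 f p := hf.of_le (WithTop.coe_le_coe.2 le_top)
  refine (key m k).trans (EventuallyEq.trans ?_ (key k m).symm)
  filter_upwards [h2.eventually (by simp)] with z hz
  exact (hz.isSymmSndFDerivAt (by simp)) _ _

theorem partialDeriv_add {f g : (Fin n → ℝ) → ℝ} {p : Fin n → ℝ}
    (hf : ContDiffAt ℝ ∞ f p) (hg : ContDiffAt ℝ ∞ g p) (m : Fin n) :
    partialDeriv m (f + g) =ᶠ[𝓝 p] partialDeriv m f + partialDeriv m g := by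
  filter_upwards [eventually_differentiableAt hf, eventually_differentiableAt hg] with z h1 h2
  simp only [partialDeriv, Pi.add_apply]
  rw [(h1.add h2).lineDeriv_eq_fderiv, h1.lineDeriv_eq_fderiv, h2.lineDeriv_eq_fderiv,
    fderiv_add h1 h2]
  rfl

theorem partialDeriv_mul {f g : (Fin n → ℝ) → ℝ} {p : Fin n → ℝ}
    (hf : ContDiffAt ℝ ∞ f p) (hg : ContDiffAt ℝ ∞ g p) (m : Fin n) :
    partialDeriv m (f * g) =ᶠ[𝓝 p] partialDeriv m f * g + f * partialDeriv m g := by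
  filter_upwards [eventually_differentiableAt hf, eventually_differentiableAt hg] with z h1 h2
  simp only [partialDeriv, Pi.add_apply, Pi.mul_apply]
  rw [(h1.mul h2).lineDeriv_eq_fderiv, h1.lineDeriv_eq_fderiv, h2.lineDeriv_eq_fderiv,
    fderiv_mul h1 h2]
  simp
  ring

theorem partialDeriv_comp {f : (Fin d → ℝ) → ℝ} {g : (Fin n → ℝ) → (Fin d → ℝ)} {p : Fin n → ℝ}
    (hf : ContDiffAt ℝ ∞ f (g p)) (hg : ContDiffAt ℝ ∞ g p) (m : Fin n) :
    partialDeriv m (f ∘ g) =ᶠ[𝓝 p]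
      ∑ k, (partialDeriv k f ∘ g) * partialDeriv m (fun z => g z k) := by
  filter_upwards [hg.continuousAt.eventually (eventually_differentiableAt hf),
    eventually_differentiableAt hg] with z h1 h2
  simp only [partialDeriv, Finset.sum_apply, Pi.mul_apply, Function.comp_apply]
  rw [(h1.comp z h2).lineDeriv_eq_fderiv, fderiv_comp z h1 h2]
  have h3 : ∀ k, lineDeriv ℝ (fun z => g z k) z (Pi.single m 1) =
      fderiv ℝ g z (Pi.single m 1) k := by
    intro k
    rw [((differentiableAt_pi.1 h2) k).lineDeriv_eq_fderiv, fderiv_apply h2]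
    rfl
  simp only [h3, h1.lineDeriv_eq_fderiv]
  rw [ContinuousLinearMap.comp_apply]
  conv_lhs => rw [pi_eq_sum_univ' (fderiv ℝ g z (Pi.single m 1)), map_sum]
  refine Finset.sum_congr rfl fun k _ => ?_
  rw [map_smul, smul_eq_mul, mul_comm]

/-! ### Derivatives along words of indices -/

/-- The iterated partial derivative along a word of coordinate indices. -/
def wordDeriv (w : List (Fin n)) (f : (Fin n → ℝ) → ℝ) : (Fin n → ℝ) → ℝ :=
  w.foldr partialDeriv f

theorem wordDeriv_eventuallyEq {f g : (Fin n → ℝ) → ℝ} {p : Fin n → ℝ} (h : f =ᶠ[𝓝 p] g)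
    (w : List (Fin n)) : wordDeriv w f =ᶠ[𝓝 p] wordDeriv w g := by
  induction w with
  | nil => exact h
  | cons m w ih => exact partialDeriv_eventuallyEq ih m

theorem contDiffAt_wordDeriv {f : (Fin n → ℝ) → ℝ} {p : Fin n → ℝ}
    (hf : ContDiffAt ℝ ∞ f p) (w : List (Fin n)) : ContDiffAt ℝ ∞ (wordDeriv w f) p := by
  induction w with
  | nil => exact hf
  | cons m w ih => exact contDiffAt_partialDeriv ih m

theorem wordDeriv_perm {f : (Fin n → ℝ) → ℝ} {p : Fin n → ℝ} (hf : ContDiffAt ℝ ∞ f p)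
    {w w' : List (Fin n)} (h : w.Perm w') : wordDeriv w f =ᶠ[𝓝 p] wordDeriv w' f := by
  induction h with
  | nil => rfl
  | cons m _ ih => exact partialDeriv_eventuallyEq ih m
  | swap m k w => exact partialDeriv_comm (contDiffAt_wordDeriv hf w) k m
  | trans _ _ ih₁ ih₂ => exact ih₁.trans ih₂

/-- The word listing each index `m` with multiplicity `i m`, in increasing order. -/
def multiIndexWord (i : Fin n →₀ ℕ) : List (Fin n) :=
  (List.finRange n).flatMap fun m => List.replicate (i m) m

theorem toFinsupp_multiIndexWord (i : Fin n →₀ ℕ) :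
    Multiset.toFinsupp (multiIndexWord i : Multiset (Fin n)) = i := by
  ext m
  rw [Multiset.toFinsupp_apply, Multiset.coe_count, multiIndexWord, List.count_flatMap]
  have : (List.map (List.count m ∘ fun k => List.replicate (i k) k) (List.finRange n)).sum
      = ∑ k, if k = m then i k else 0 := by
    rw [← List.sum_ofFn, List.ofFn_eq_map]
    simp [Function.comp_def, List.count_replicate]
  rw [this]
  simp

theorem multiIndexWord_perm (w : List (Fin n)) :
    (multiIndexWord (Multiset.toFinsupp (w : Multiset (Fin n)))).Perm w := by
  rw [← Multiset.coe_eq_coe]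
  exact Multiset.toFinsupp.injective (toFinsupp_multiIndexWord _)

theorem length_multiIndexWord (i : Fin n →₀ ℕ) : (multiIndexWord i).length = i.degree := by
  rw [multiIndexWord, List.length_flatMap]
  simp [Finsupp.degree_eq_sum, ← List.sum_ofFn, List.ofFn_eq_map]

theorem mixedPartial_eq_wordDeriv (i : Fin n →₀ ℕ) (f : (Fin n → ℝ) → ℝ) :
    mixedPartial i f = wordDeriv (multiIndexWord i) f := by
  unfold mixedPartial wordDeriv multiIndexWord
  induction List.finRange n with
  | nil => rfl
  | cons m l ih =>
    rw [List.foldr_cons, List.flatMap_cons, List.foldr_append, ih]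
    generalize List.foldr partialDeriv f (List.flatMap _ l) = h
    induction i m with
    | zero => rfl
    | succ r ihr => rw [Function.iterate_succ_apply', ihr]; rfl

theorem mixedPartial_congr {f g : (Fin n → ℝ) → ℝ} {p : Fin n → ℝ} (h : f =ᶠ[𝓝 p] g)
    (i : Fin n →₀ ℕ) : mixedPartial i f p = mixedPartial i g p := by
  rw [mixedPartial_eq_wordDeriv, mixedPartial_eq_wordDeriv]
  exact (wordDeriv_eventuallyEq h _).eq_of_nhds

/-- Partial derivatives of a smooth germ commute, so only the multiplicities of the letters matter.
Words allow inductions that split off one derivative at a time; this lemma returns to multi-indices.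
-/
theorem wordDeriv_apply_eq_mixedPartial {f : (Fin n → ℝ) → ℝ} {p : Fin n → ℝ}
    (hf : ContDiffAt ℝ ∞ f p) (w : List (Fin n)) :
    wordDeriv w f p = mixedPartial (Multiset.toFinsupp (w : Multiset (Fin n))) f p := by
  rw [mixedPartial_eq_wordDeriv]
  exact (wordDeriv_perm hf (multiIndexWord_perm w)).eq_of_nhds.symm

theorem wordDeriv_add {f g : (Fin n → ℝ) → ℝ} {p : Fin n → ℝ}
    (hf : ContDiffAt ℝ ∞ f p) (hg : ContDiffAt ℝ ∞ g p) (w : List (Fin n)) :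
    wordDeriv w (f + g) =ᶠ[𝓝 p] wordDeriv w f + wordDeriv w g := by
  induction w with
  | nil => rfl
  | cons m w ih =>
    exact (partialDeriv_eventuallyEq ih m).trans
      (partialDeriv_add (contDiffAt_wordDeriv hf w) (contDiffAt_wordDeriv hg w) m)

/-! ### Functions vanishing to a given order -/

/-- All partial derivatives of `f` of order at most `N` vanish at `p`. -/
def VanishesToOrder (N : ℕ) (f : (Fin n → ℝ) → ℝ) (p : Fin n → ℝ) : Prop :=
  ∀ w : List (Fin n), w.length ≤ N → wordDeriv w f p = 0

theorem vanishesToOrder_of_mixedPartial {N : ℕ} {f : (Fin n → ℝ) → ℝ} {p : Fin n → ℝ}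
    (hf : ContDiffAt ℝ ∞ f p) (h : ∀ i : Fin n →₀ ℕ, i.degree ≤ N → mixedPartial i f p = 0) :
    VanishesToOrder N f p := by
  intro w hw
  rw [wordDeriv_apply_eq_mixedPartial hf]
  apply h
  rwa [← length_multiIndexWord, (multiIndexWord_perm w).length_eq]

namespace VanishesToOrder

variable {N : ℕ} {f g : (Fin n → ℝ) → ℝ} {p : Fin n → ℝ}

theorem mixedPartial_eq_zero (h : VanishesToOrder N f p) {i : Fin n →₀ ℕ} (hi : i.degree ≤ N) :
    mixedPartial i f p = 0 := by
  rw [mixedPartial_eq_wordDeriv]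
  exact h _ (by rwa [length_multiIndexWord])

theorem apply_eq_zero (h : VanishesToOrder N f p) : f p = 0 := h [] (Nat.zero_le _)

theorem congr (h : VanishesToOrder N f p) (hfg : f =ᶠ[𝓝 p] g) : VanishesToOrder N g p := by
  intro w hw
  rw [← h w hw]
  exact (wordDeriv_eventuallyEq hfg w).eq_of_nhds.symm

theorem of_succ (h : VanishesToOrder (N + 1) f p) : VanishesToOrder N f p :=
  fun w hw => h w (by omega)

theorem partialDeriv (h : VanishesToOrder (N + 1) f p) (m : Fin n) :
    VanishesToOrder N (partialDeriv m f) p := by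
  intro w hw
  have := h (w ++ [m]) (by simpa using hw)
  rwa [wordDeriv, List.foldr_append] at this

/-- The last letter of a word acts first, so every nonempty word is a shorter word applied to some
`∂_m f`. The closure properties below are proved by this recursion on the order. -/
theorem succ (h0 : f p = 0) (h : ∀ m, VanishesToOrder N (SubLevy.partialDeriv m f) p) :
    VanishesToOrder (N + 1) f p := by
  intro w hw
  rcases List.eq_nil_or_concat w with rfl | ⟨w', m, rfl⟩
  · exact h0
  · rw [wordDeriv, List.concat_eq_append, List.foldr_append]
    exact h m w' (by simpa using hw)

theorem zero : VanishesToOrder N (0 : (Fin n → ℝ) → ℝ) p := by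
  induction N with
  | zero =>
    intro w hw
    obtain rfl : w = [] := by simpa using hw
    rfl
  | succ N ih =>
    refine succ rfl fun m => ?_
    have : SubLevy.partialDeriv m (0 : (Fin n → ℝ) → ℝ) = 0 := by
      ext z
      simp [SubLevy.partialDeriv, lineDeriv]
    rwa [this]

theorem add (hf : ContDiffAt ℝ ∞ f p) (hg : ContDiffAt ℝ ∞ g p)
    (h₁ : VanishesToOrder N f p) (h₂ : VanishesToOrder N g p) : VanishesToOrder N (f + g) p := by
  intro w hw
  rw [(wordDeriv_add hf hg w).eq_of_nhds, Pi.add_apply, h₁ w hw, h₂ w hw, add_zero]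

theorem sum {ι : Type*} (s : Finset ι) {F : ι → (Fin n → ℝ) → ℝ}
    (hF : ∀ k, ContDiffAt ℝ ∞ (F k) p) (h : ∀ k, VanishesToOrder N (F k) p) :
    VanishesToOrder N (∑ k ∈ s, F k) p := by
  classical
  induction s using Finset.induction_on with
  | empty => simpa using zero
  | insert k s hk ih =>
    rw [Finset.sum_insert hk]
    refine add (hF k) ?_ (h k) ih
    have := ContDiffAt.sum (s := s) fun k _ => hF k
    simpa [Finset.sum_fn] using this

/-- An ideal property: in `∂f · g + f · ∂g` the factors `∂f` and `f` both vanish to order `N`.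
Either factor may be the one differentiated, so the induction lets both vary. -/
theorem mul_right (hf : ContDiffAt ℝ ∞ f p) (hg : ContDiffAt ℝ ∞ g p)
    (h : VanishesToOrder N f p) : VanishesToOrder N (f * g) p := by
  induction N generalizing f g with
  | zero =>
    intro w hw
    obtain rfl : w = [] := by simpa using hw
    have := h.apply_eq_zero
    simp [wordDeriv, this]
  | succ N ih =>
    refine succ (by simp [h.apply_eq_zero]) fun m => ?_
    refine congr ?_ (partialDeriv_mul hf hg m).symm
    exact add ((contDiffAt_partialDeriv hf m).mul hg) (hf.mul (contDiffAt_partialDeriv hg m))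
      (ih (contDiffAt_partialDeriv hf m) hg (h.partialDeriv m))
      (ih hf (contDiffAt_partialDeriv hg m) h.of_succ)

/-- By the chain rule `∂_m (f ∘ g)` is a sum of terms `(∂_k f ∘ g) · ∂_m g_k`. Induction applies to
`∂_k f`, and the ideal property absorbs the other factor. -/
theorem comp {f : (Fin d → ℝ) → ℝ} {g : (Fin n → ℝ) → (Fin d → ℝ)}
    (hf : ContDiffAt ℝ ∞ f (g p)) (hg : ContDiffAt ℝ ∞ g p)
    (h : VanishesToOrder N f (g p)) : VanishesToOrder N (f ∘ g) p := by
  induction N generalizing f with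
  | zero =>
    intro w hw
    obtain rfl : w = [] := by simpa using hw
    exact h.apply_eq_zero
  | succ N ih =>
    refine succ h.apply_eq_zero fun m => ?_
    refine congr ?_ (partialDeriv_comp hf hg m).symm
    have hgm : ∀ k, ContDiffAt ℝ ∞ (SubLevy.partialDeriv m fun z => g z k) p := fun k =>
      contDiffAt_partialDeriv (contDiffAt_pi.1 hg k) m
    have hfk : ∀ k, ContDiffAt ℝ ∞ (SubLevy.partialDeriv k f ∘ g) p := fun k =>
      (contDiffAt_partialDeriv hf k).comp p hg
    exact sum _ (fun k => (hfk k).mul (hgm k)) fun k =>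
      mul_right (hfk k) (hgm k) (ih (contDiffAt_partialDeriv hf k) (h.partialDeriv k))

end VanishesToOrder

/-! ### Polynomial functions -/

theorem contDiff_mvPolynomial_eval (q : MvPolynomial (Fin n) ℝ) :
    ContDiff ℝ ∞ fun z => MvPolynomial.eval z q := by
  induction q using MvPolynomial.induction_on with
  | C a => simpa using contDiff_const
  | add q r hq hr => simpa using hq.add hr
  | mul_X q k hq => simpa using hq.mul (contDiff_apply ℝ ℝ k)

theorem partialDeriv_mvPolynomial_eval (m : Fin n) (q : MvPolynomial (Fin n) ℝ) :
    partialDeriv m (fun z => MvPolynomial.eval z q) =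
      fun z => MvPolynomial.eval z (MvPolynomial.pderiv m q) := by
  have hs := fun (q : MvPolynomial (Fin n) ℝ) (z : Fin n → ℝ) =>
    (contDiff_mvPolynomial_eval q).contDiffAt (x := z)
  induction q using MvPolynomial.induction_on with
  | C a =>
    ext z
    simp [partialDeriv, lineDeriv]
  | add q r hq hr =>
    ext z
    have := (partialDeriv_add (hs q z) (hs r z) m).eq_of_nhds
    rw [hq, hr] at this
    simpa [Pi.add_def] using this
  | mul_X q k hq =>
    ext z
    have hX : partialDeriv m (fun z : Fin n → ℝ => z k) z = (Pi.single m 1 : Fin n → ℝ) k := by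
      rw [partialDeriv, (differentiableAt_apply k z).lineDeriv_eq_fderiv,
        (hasFDerivAt_apply k z).fderiv]
      rfl
    have := (partialDeriv_mul (hs q z) (contDiff_apply ℝ ℝ k).contDiffAt m).eq_of_nhds
    rw [hq] at this
    simp only [Pi.mul_def, Pi.add_apply] at this
    simp only [map_mul, MvPolynomial.eval_X, this, hX, MvPolynomial.pderiv_mul, map_add,
      MvPolynomial.pderiv_X]
    by_cases h : m = k
    · subst h; simp
    · simp [Ne.symm h]

theorem multiFactorial_add_single (j : Fin n →₀ ℕ) (m : Fin n) :
    multiFactorial (j + Finsupp.single m 1) = (j m + 1) * multiFactorial j := by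
  unfold multiFactorial
  rw [← Finset.mul_prod_erase _ _ (Finset.mem_univ m),
    ← Finset.mul_prod_erase _ (fun k => (j k)!) (Finset.mem_univ m), ← mul_assoc]
  congr 1
  · simp [Nat.factorial_succ]
  · refine Finset.prod_congr rfl fun k hk => ?_
    simp [(Finset.ne_of_mem_erase hk).symm]

theorem wordDeriv_mvPolynomial_eval (w : List (Fin n)) (q : MvPolynomial (Fin n) ℝ) :
    wordDeriv w (fun z => MvPolynomial.eval z q) =
      fun z => MvPolynomial.eval z (w.foldr (fun m r => MvPolynomial.pderiv m r) q) := by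
  induction w with
  | nil => rfl
  | cons m w ih =>
    rw [wordDeriv, List.foldr_cons, List.foldr_cons, ← partialDeriv_mvPolynomial_eval]
    exact congrArg _ ih

/-- In the normalization `j! · coeff j`, each `∂_m` is a pure shift of the index by the `m`-th unit
vector. -/
theorem multiFactorial_mul_coeff_foldr_pderiv (w : List (Fin n)) (q : MvPolynomial (Fin n) ℝ)
    (j : Fin n →₀ ℕ) :
    multiFactorial j * (w.foldr (fun m r => MvPolynomial.pderiv m r) q).coeff j =
      multiFactorial (j + Multiset.toFinsupp (w : Multiset (Fin n))) *
        q.coeff (j + Multiset.toFinsupp (w : Multiset (Fin n))) := by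
  induction w generalizing j with
  | nil => simp
  | cons m w ih =>
    have h : j + Multiset.toFinsupp ((m :: w : List (Fin n)) : Multiset (Fin n)) =
        j + Finsupp.single m 1 + Multiset.toFinsupp (w : Multiset (Fin n)) := by
      rw [← Multiset.cons_coe, ← Multiset.singleton_add, map_add, Multiset.toFinsupp_singleton,
        add_assoc]
    rw [h, ← ih, List.foldr_cons, MvPolynomial.coeff_pderiv, multiFactorial_add_single]
    push_cast
    ring

theorem mixedPartial_mvPolynomial_eval_zero (i : Fin n →₀ ℕ) (q : MvPolynomial (Fin n) ℝ) :
    mixedPartial i (fun z => MvPolynomial.eval z q) 0 = multiFactorial i * q.coeff i := by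
  rw [mixedPartial_eq_wordDeriv, wordDeriv_mvPolynomial_eval]
  have h := multiFactorial_mul_coeff_foldr_pderiv (multiIndexWord i) q 0
  rw [toFinsupp_multiIndexWord, zero_add] at h
  rw [← h]
  simp [multiFactorial, MvPolynomial.constantCoeff_eq]

end Jets

/-! ### Coefficients of composed Taylor polynomials and the Faà di Bruno formula -/

section FaaDiBruno

variable {n d : ℕ}

/-- A finite box of multi-indices containing all those of degree at most `N`. -/
def multiBox (n N : ℕ) : Finset (Fin n →₀ ℕ) :=
  Finset.Iic (Finsupp.equivFunOnFinite.symm fun _ => N)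

theorem mem_multiBox {N : ℕ} {j : Fin n →₀ ℕ} : j ∈ multiBox n N ↔ ∀ m, j m ≤ N := by
  simp [multiBox, Finsupp.le_def]

theorem mem_multiBox_of_degree_le {N : ℕ} {j : Fin n →₀ ℕ} (h : j.degree ≤ N) :
    j ∈ multiBox n N :=
  mem_multiBox.2 fun m => (Finsupp.le_degree m j).trans h

theorem multiFactorial_ne_zero (j : Fin n →₀ ℕ) : (multiFactorial j : ℝ) ≠ 0 := by
  rw [Nat.cast_ne_zero, multiFactorial]
  exact Finset.prod_ne_zero_iff.2 fun m _ => Nat.factorial_ne_zero _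

/-- The polynomial `∑ c_j z^j / j!`, the sum being over a box of multi-indices. -/
def taylorPoly (N : ℕ) (c : (Fin n →₀ ℕ) → ℝ) : MvPolynomial (Fin n) ℝ :=
  ∑ j ∈ multiBox n N, MvPolynomial.monomial j (c j / multiFactorial j)

theorem coeff_taylorPoly {N : ℕ} (c : (Fin n →₀ ℕ) → ℝ) {j : Fin n →₀ ℕ}
    (hj : j ∈ multiBox n N) : (taylorPoly N c).coeff j = c j / multiFactorial j := by
  classical
  simp [taylorPoly, MvPolynomial.coeff_sum, MvPolynomial.coeff_monomial, hj]

theorem prod_map_monomial {σ : Type*} (M : Multiset (σ →₀ ℕ)) (b : (σ →₀ ℕ) → ℝ) :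
    (M.map fun l => MvPolynomial.monomial l (b l)).prod =
      MvPolynomial.monomial M.sum (M.map b).prod := by
  induction M using Multiset.induction_on with
  | empty => simp
  | cons a M ih =>
    rw [Multiset.map_cons, Multiset.prod_cons, ih, Multiset.sum_cons, Multiset.map_cons,
      Multiset.prod_cons, MvPolynomial.monomial_mul]

theorem countPerms_mul_prod_factorial {α : Type*} [DecidableEq α] (M : Multiset α) :
    M.countPerms * ∏ c ∈ M.toFinset, (M.count c)! = (M.card)! := by
  have h := Nat.multinomial_spec M.toFinset (fun c => M.count c)
  rw [Multiset.toFinset_sum_count_eq] at h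
  rw [← h, mul_comm]
  congr 1

/-- The multinomial theorem indexes the terms of the `r`-th power by multisets of `r` multi-indices,
with weight `r! / 𝔪(Λ)!`. Since `c 0 = 0`, only nonzero columns remain, so the multisets with sum
`s` are the partitions of `s` of length `r`. The bound on `s.degree` keeps every column inside the
truncation box. -/
theorem coeff_taylorPoly_pow {N : ℕ} {c : (Fin n →₀ ℕ) → ℝ} (hc : c 0 = 0) {s : Fin n →₀ ℕ}
    (hs : s.degree ≤ N) (r : ℕ) :
    (taylorPoly N c ^ r).coeff s = r ! * ∑ L : MultiPartition s,
      if L.length = r then L.assoc c / (L.factorial * L.multFactorial) else 0 := by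
  classical
  have h0 : taylorPoly N c = ∑ j ∈ (multiBox n N).erase 0,
      MvPolynomial.monomial j (c j / multiFactorial j) := by
    rw [taylorPoly, Finset.sum_erase]
    simp [hc]
  rw [h0, Finset.sum_pow, MvPolynomial.coeff_sum, ← Finset.sum_filter, Finset.mul_sum]
  have hterm : ∀ M : Sym (Fin n →₀ ℕ) r, MvPolynomial.coeff s
      ((M.val.countPerms : MvPolynomial (Fin n) ℝ) *
        (M.val.map fun j => MvPolynomial.monomial j (c j / multiFactorial j)).prod) =
      if M.val.sum = s then (M.val.countPerms : ℝ) *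
        ((M.val.map c).prod / (M.val.map fun j => (multiFactorial j : ℝ)).prod) else 0 := by
    intro M
    rw [prod_map_monomial, ← map_natCast (MvPolynomial.C (σ := Fin n) (R := ℝ)),
      MvPolynomial.coeff_C_mul, MvPolynomial.coeff_monomial, Multiset.prod_map_div,
      mul_ite, mul_zero]
  simp only [hterm]
  rw [← Finset.sum_filter]
  symm
  refine Finset.sum_bij (fun L hL => ⟨L.cols, (Finset.mem_filter.1 hL).2⟩) ?_ ?_ ?_ ?_
  · intro L hL
    refine Finset.mem_filter.2 ⟨Finset.mem_sym_iff.2 fun a (ha : a ∈ L.cols) => ?_, L.sum_eq⟩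
    refine Finset.mem_erase.2 ⟨L.ne_zero a ha, ?_⟩
    have ha' : a ≤ s := by
      rw [← L.sum_eq]
      exact Multiset.single_le_sum (fun _ _ => zero_le) a ha
    exact mem_multiBox.2 fun m => (ha' m).trans ((Finsupp.le_degree m s).trans hs)
  · intro L _ L' _ h
    exact MultiPartition.ext (congrArg Subtype.val h)
  · intro M hM
    rw [Finset.mem_filter, Finset.mem_sym_iff] at hM
    exact ⟨⟨M.val, fun a ha => (Finset.mem_erase.1 (hM.1 a ha)).1, hM.2⟩,
      Finset.mem_filter.2 ⟨Finset.mem_univ _, M.2⟩, rfl⟩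
  · intro L hL
    have hL' : L.cols.card = r := (Finset.mem_filter.1 hL).2
    have h1 := countPerms_mul_prod_factorial L.cols
    rw [hL'] at h1
    have h2 : (L.multFactorial : ℝ) ≠ 0 := by
      rw [Nat.cast_ne_zero, MultiPartition.multFactorial]
      exact Finset.prod_ne_zero_iff.2 fun m _ => Nat.factorial_ne_zero _
    have h3 : (r ! : ℝ) = L.cols.countPerms * L.multFactorial := by
      rw [← h1, MultiPartition.multFactorial]
      push_cast
      rfl
    have h4 : (L.factorial : ℝ) = (L.cols.map fun j => (multiFactorial j : ℝ)).prod := by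
      rw [MultiPartition.factorial, Nat.cast_multiset_prod, Multiset.map_map]
      rfl
    rw [h3, h4, MultiPartition.assoc]
    field_simp

theorem coeff_prod_univ (R : Fin d → MvPolynomial (Fin n) ℝ) (i : Fin n →₀ ℕ) :
    (∏ k, R k).coeff i =
      ∑ s ∈ Finset.piAntidiag (Finset.univ : Finset (Fin d)) i, ∏ k, (R k).coeff (s k) := by
  classical
  rw [← MvPolynomial.coeff_coe, ← MvPolynomial.coeToMvPowerSeries.ringHom_apply, map_prod,
    MvPowerSeries.coeff_prod]
  refine Finset.sum_bij' (fun s _ => ⇑s) (fun s _ => Finsupp.equivFunOnFinite.symm s)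
    ?_ ?_ ?_ ?_ ?_
  · intro s hs
    simpa [Finset.mem_finsuppAntidiag, Finset.mem_piAntidiag] using hs
  · intro s hs
    simpa [Finset.mem_finsuppAntidiag, Finset.mem_piAntidiag] using hs
  · intro s _; ext; simp
  · intro s _; rfl
  · intro s _; simp

theorem MultiPartition.length_le_degree {s : Fin n →₀ ℕ} (L : MultiPartition s) :
    L.length ≤ s.degree := by
  have := MultiPartition.degree_sum_ge L.cols L.ne_zero
  rwa [L.sum_eq] at this

theorem le_of_mem_piAntidiag {i : Fin n →₀ ℕ} {s : Fin d → (Fin n →₀ ℕ)}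
    (hs : s ∈ Finset.piAntidiag (Finset.univ : Finset (Fin d)) i) (k : Fin d) : s k ≤ i := by
  rw [Finset.mem_piAntidiag] at hs
  rw [← hs.1]
  exact Finset.single_le_sum (f := s) (fun _ _ => zero_le) (Finset.mem_univ k)

theorem constr_bellPolynomial (c : (Fin d →₀ ℕ) → ℝ) (g : Fin d → (Fin n →₀ ℕ) → ℝ)
    (i : Fin n →₀ ℕ) :
    (MvPolynomial.basisMonomials (Fin d) ℝ).constr ℝ c (bellPolynomial g i) =
      multiFactorial i * ∑ s ∈ Finset.piAntidiag (Finset.univ : Finset (Fin d)) i,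
        ∑ L : (∀ k, MultiPartition (s k)),
          c (Finsupp.equivFunOnFinite.symm fun k => (L k).length) *
            ∏ k, ((L k).assoc (g k) / ((L k).factorial * (L k).multFactorial)) := by
  have hmon : ∀ (j : Fin d →₀ ℕ) (a : ℝ), (MvPolynomial.basisMonomials (Fin d) ℝ).constr ℝ c
      (MvPolynomial.monomial j a) = c j * a := by
    intro j a
    have h : MvPolynomial.monomial j a = a • MvPolynomial.basisMonomials (Fin d) ℝ j := by
      simp [MvPolynomial.smul_monomial]
    rw [h, map_smul, Module.Basis.constr_basis, smul_eq_mul, mul_comm]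
  rw [bellPolynomial, ← MvPolynomial.smul_eq_C_mul, map_smul, smul_eq_mul, map_sum]
  congr 1
  refine Finset.sum_congr rfl fun s _ => ?_
  rw [map_sum]
  refine Finset.sum_congr rfl fun L _ => ?_
  have h : (∏ k, MvPolynomial.X k ^ (L k).length : MvPolynomial (Fin d) ℝ) =
      MvPolynomial.monomial (Finsupp.equivFunOnFinite.symm fun k => (L k).length) 1 := by
    rw [MvPolynomial.monomial_eq, Finsupp.prod_fintype _ _ (by simp)]
    simp
  rw [h, mul_comm, MvPolynomial.C_mul_monomial, mul_one, hmon, Finset.prod_div_distrib,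
    Finset.prod_mul_distrib]

/-- In the contribution of `c_j x^j / j!`, the factors `(j k)!` coming from the powers of the inner
polynomials cancel `j!`. For a fixed tuple of partitions, exactly one `j` survives: the tuple of
their lengths. -/
theorem coeff_bind_taylorPoly {N : ℕ} (c : (Fin d →₀ ℕ) → ℝ) (g : Fin d → (Fin n →₀ ℕ) → ℝ)
    (hg : ∀ k, g k 0 = 0) (i : Fin n →₀ ℕ) (hi : i.degree ≤ N) :
    (MvPolynomial.bind₁ (fun k => taylorPoly N (g k)) (taylorPoly N c)).coeff i =
      ∑ s ∈ Finset.piAntidiag (Finset.univ : Finset (Fin d)) i,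
        ∑ L : (∀ k, MultiPartition (s k)),
          c (Finsupp.equivFunOnFinite.symm fun k => (L k).length) *
            ∏ k, ((L k).assoc (g k) / ((L k).factorial * (L k).multFactorial)) := by
  classical
  have hterm : ∀ j : Fin d →₀ ℕ, (MvPolynomial.bind₁ (fun k => taylorPoly N (g k))
      (MvPolynomial.monomial j (c j / multiFactorial j))).coeff i =
      ∑ s ∈ Finset.piAntidiag (Finset.univ : Finset (Fin d)) i,
        ∑ L : (∀ k, MultiPartition (s k)), c j * ∏ k, if (L k).length = j k then
          (L k).assoc (g k) / ((L k).factorial * (L k).multFactorial) else 0 := by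
    intro j
    have hsupp : ∏ k ∈ j.support, taylorPoly N (g k) ^ j k = ∏ k, taylorPoly N (g k) ^ j k :=
      Finset.prod_subset (Finset.subset_univ _) fun k _ hk => by
        rw [Finsupp.notMem_support_iff.1 hk, pow_zero]
    rw [MvPolynomial.bind₁_monomial, MvPolynomial.coeff_C_mul, hsupp, coeff_prod_univ,
      Finset.mul_sum]
    refine Finset.sum_congr rfl fun s hs => ?_
    have hdeg : ∀ k, (s k).degree ≤ N := fun k =>
      (Finsupp.degree_mono (le_of_mem_piAntidiag hs k)).trans hi
    rw [Finset.prod_congr rfl fun k _ => coeff_taylorPoly_pow (hg k) (hdeg k) (j k),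
      Finset.prod_mul_distrib, Fintype.prod_sum, ← mul_assoc, ← Finset.mul_sum]
    congr 1
    have := multiFactorial_ne_zero j
    rw [← Nat.cast_prod, show ∏ k, (j k)! = multiFactorial j from rfl]
    field_simp
  rw [taylorPoly, map_sum, MvPolynomial.coeff_sum, Finset.sum_congr rfl fun j _ => hterm j,
    Finset.sum_comm]
  refine Finset.sum_congr rfl fun s hs => ?_
  rw [Finset.sum_comm]
  refine Finset.sum_congr rfl fun L _ => ?_
  rw [Finset.sum_eq_single (Finsupp.equivFunOnFinite.symm fun k => (L k).length)]
  · simp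
  · intro j _ hj
    obtain ⟨k, hk⟩ : ∃ k, (L k).length ≠ j k := by
      by_contra! h
      apply hj
      ext k
      simp [h k]
    rw [Finset.prod_eq_zero (Finset.mem_univ k) (if_neg hk), mul_zero]
  · intro h
    -- A partition has at most as many columns as the degree of its sum, so truncating the outer
    -- polynomial loses no term.
    refine absurd (mem_multiBox.2 fun k => ?_) h
    exact (L k).length_le_degree.trans
      ((Finsupp.degree_mono (le_of_mem_piAntidiag hs k)).trans hi)

open scoped ContDiff

theorem mixedPartial_eq_of_vanishesToOrder_sub {N : ℕ} {f g : (Fin n → ℝ) → ℝ} {p : Fin n → ℝ}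
    (hf : ContDiffAt ℝ ∞ f p) (hg : ContDiffAt ℝ ∞ g p) (h : VanishesToOrder N (f - g) p)
    {i : Fin n →₀ ℕ} (hi : i.degree ≤ N) : mixedPartial i f p = mixedPartial i g p := by
  have h1 := (wordDeriv_add (hf.sub hg) hg (multiIndexWord i)).eq_of_nhds
  have h2 : (fun z => f z - g z) + g = f := by ext z; simp
  have h3 := h.mixedPartial_eq_zero hi
  rw [h2] at h1
  rw [mixedPartial_eq_wordDeriv] at h3 ⊢
  rw [h1, Pi.add_apply, mixedPartial_eq_wordDeriv]
  change wordDeriv _ (f - g) p + _ = _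
  rw [h3, zero_add]

theorem vanishesToOrder_sub_taylorPoly (N : ℕ) {f : (Fin n → ℝ) → ℝ} (hf : ContDiffAt ℝ ∞ f 0) :
    VanishesToOrder N
      (f - fun z => MvPolynomial.eval z (taylorPoly N fun j => mixedPartial j f 0)) 0 := by
  set q := taylorPoly N fun j => mixedPartial j f 0 with hq
  have hs : ∀ r : MvPolynomial (Fin n) ℝ, ContDiffAt ℝ ∞ (fun z => MvPolynomial.eval z r) 0 :=
    fun r => (contDiff_mvPolynomial_eval r).contDiffAt
  have hneg : (f - fun z => MvPolynomial.eval z q) = f + fun z => MvPolynomial.eval z (-q) := by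
    ext z; simp [sub_eq_add_neg]
  rw [hneg]
  refine vanishesToOrder_of_mixedPartial (hf.add (hs _)) fun i hi => ?_
  rw [mixedPartial_eq_wordDeriv, (wordDeriv_add hf (hs _) _).eq_of_nhds, Pi.add_apply,
    ← mixedPartial_eq_wordDeriv, ← mixedPartial_eq_wordDeriv,
    mixedPartial_mvPolynomial_eval_zero, MvPolynomial.coeff_neg, hq,
    coeff_taylorPoly _ (mem_multiBox_of_degree_le hi)]
  have := multiFactorial_ne_zero i
  field_simp
  ring

theorem vanishesToOrder_eval_sub_eval {N : ℕ} {p : Fin n → ℝ} {g h : (Fin n → ℝ) → (Fin d → ℝ)}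
    (hg : ContDiffAt ℝ ∞ g p) (hh : ContDiffAt ℝ ∞ h p)
    (hgh : ∀ k, VanishesToOrder N ((fun z => g z k) - fun z => h z k) p)
    (q : MvPolynomial (Fin d) ℝ) :
    VanishesToOrder N
      ((fun z => MvPolynomial.eval (g z) q) - fun z => MvPolynomial.eval (h z) q) p := by
  have hgk := contDiffAt_pi.1 hg
  have hhk := contDiffAt_pi.1 hh
  have hG : ∀ r : MvPolynomial (Fin d) ℝ, ContDiffAt ℝ ∞ (fun z => MvPolynomial.eval (g z) r) p :=
    fun r => (contDiff_mvPolynomial_eval r).contDiffAt.comp p hg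
  have hH : ∀ r : MvPolynomial (Fin d) ℝ, ContDiffAt ℝ ∞ (fun z => MvPolynomial.eval (h z) r) p :=
    fun r => (contDiff_mvPolynomial_eval r).contDiffAt.comp p hh
  induction q using MvPolynomial.induction_on with
  | C a => simpa using VanishesToOrder.zero
  | add q r hq hr =>
    refine (hq.add ((hG q).sub (hH q)) ((hG r).sub (hH r)) hr).congr (.of_eq ?_)
    ext z
    simp
    ring
  | mul_X q k hq =>
    -- This uses `q(g) g_k - q(h) h_k = (q(g) - q(h)) g_k + (g_k - h_k) q(h)`, both summands lying
    -- in the ideal.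
    refine ((hq.mul_right ((hG q).sub (hH q)) (hgk k)).add
      (((hG q).sub (hH q)).mul (hgk k)) (((hgk k).sub (hhk k)).mul (hH q))
      ((hgh k).mul_right ((hgk k).sub (hhk k)) (hH q))).congr (.of_eq ?_)
    ext z
    simp
    ring

/-- The multivariate Faà di Bruno formula at the origin, in terms of Bell polynomials. -/
theorem mixedPartial_comp_eq_constr_bellPolynomial {f : (Fin d → ℝ) → ℝ}
    {g : (Fin n → ℝ) → (Fin d → ℝ)} (hf : ContDiffAt ℝ ∞ f 0) (hg : ContDiffAt ℝ ∞ g 0)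
    (hg0 : g 0 = 0) (i : Fin n →₀ ℕ) :
    mixedPartial i (f ∘ g) 0 =
      (MvPolynomial.basisMonomials (Fin d) ℝ).constr ℝ (fun j => mixedPartial j f 0)
        (bellPolynomial (fun k l => mixedPartial l (fun z => g z k) 0) i) := by
  set N := i.degree
  set P := taylorPoly N fun j => mixedPartial j f 0
  set Q : Fin d → MvPolynomial (Fin n) ℝ :=
    fun k => taylorPoly N fun l => mixedPartial l (fun z => g z k) 0
  have hgk := contDiffAt_pi.1 hg
  have hP : ContDiffAt ℝ ∞ (fun x => MvPolynomial.eval x P) (g 0) :=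
    (contDiff_mvPolynomial_eval P).contDiffAt
  have hQs : ContDiffAt ℝ ∞ (fun z k => MvPolynomial.eval z (Q k)) (0 : Fin n → ℝ) :=
    contDiffAt_pi.2 fun k => (contDiff_mvPolynomial_eval (Q k)).contDiffAt
  have hf' : ContDiffAt ℝ ∞ f (g 0) := by rwa [hg0]
  -- Replace the outer function by its Taylor polynomial, then the inner ones; neither change
  -- affects derivatives of order at most `N`.
  have h1 : mixedPartial i (f ∘ g) 0 = mixedPartial i (fun z => MvPolynomial.eval (g z) P) 0 := by
    refine mixedPartial_eq_of_vanishesToOrder_sub (N := N) (hf'.comp 0 hg) (hP.comp 0 hg) ?_ le_rfl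
    refine VanishesToOrder.comp (f := f - fun x => MvPolynomial.eval x P) (hf'.sub hP) hg ?_
    rw [hg0]
    exact vanishesToOrder_sub_taylorPoly N hf
  have h2 : mixedPartial i (fun z => MvPolynomial.eval (g z) P) 0 =
      mixedPartial i (fun z => MvPolynomial.eval (fun k => MvPolynomial.eval z (Q k)) P) 0 := by
    refine mixedPartial_eq_of_vanishesToOrder_sub (N := N) (hP.comp 0 hg)
      ((contDiff_mvPolynomial_eval P).contDiffAt.comp 0 hQs) ?_ le_rfl
    exact vanishesToOrder_eval_sub_eval hg hQs
      (fun k => vanishesToOrder_sub_taylorPoly N (hgk k)) P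
  have h3 : (fun z : Fin n → ℝ => MvPolynomial.eval (fun k => MvPolynomial.eval z (Q k)) P) =
      fun z => MvPolynomial.eval z (MvPolynomial.bind₁ Q P) := by
    ext z
    exact (MvPolynomial.eval₂Hom_bind₁ (RingHom.id ℝ) z Q P).symm
  -- Because `g 0 = 0`, the inner Taylor polynomials have no constant term; this is what excludes
  -- zero columns.
  have h0 : ∀ k, mixedPartial (0 : Fin n →₀ ℕ) (fun z => g z k) 0 = 0 := by
    intro k
    have h : multiIndexWord (0 : Fin n →₀ ℕ) = [] := by
      rw [← List.length_eq_zero_iff, length_multiIndexWord, map_zero]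
    rw [mixedPartial_eq_wordDeriv, h, wordDeriv, List.foldr_nil, hg0]
    rfl
  rw [h1, h2, h3, mixedPartial_mvPolynomial_eval_zero, constr_bellPolynomial]
  congr 1
  exact coeff_bind_taylorPoly _ _ h0 i le_rfl

end FaaDiBruno

/-! ### Smoothness of cumulant generating functions at the origin -/

section Smoothness

open scoped ContDiff

variable {Ω : Type*} [MeasurableSpace Ω] {n d : ℕ} {P : Measure Ω}

/-- Each `exp(r |x_m|)` is at most `exp(r x_m) + exp(-r x_m)`. Multiplying out over `m` gives a
finite sum over sign vectors, each a moment generating function at a point with coordinates `±r`. -/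
theorem integrable_exp_mul_sum_abs {X : Ω → Fin n → ℝ} (hX : Measurable X) {r : ℝ}
    (h : ∀ z : Fin n → ℝ, ‖z‖ ≤ |r| → FiniteMGFAt X P z) :
    Integrable (fun ξ => Real.exp (r * ∑ m, |X ξ m|)) P := by
  have hsum : Integrable (fun ξ => ∑ σ : Fin n → Bool,
      Real.exp (∑ m, (if σ m then r else -r) * X ξ m)) P := by
    refine integrable_finsetSum _ fun σ _ => h (fun m => if σ m then r else -r) ?_
    refine (pi_norm_le_iff_of_nonneg (abs_nonneg r)).2 fun m => ?_
    by_cases hm : σ m <;> simp [hm]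
  refine hsum.mono' (by fun_prop) (.of_forall fun ξ => ?_)
  rw [Real.norm_of_nonneg (Real.exp_pos _).le]
  have h1 : ∑ σ : Fin n → Bool, Real.exp (∑ m, (if σ m then r else -r) * X ξ m) =
      ∏ m, ∑ b : Bool, Real.exp ((if b then r else -r) * X ξ m) := by
    rw [Fintype.prod_sum]
    simp only [Real.exp_sum]
  rw [h1, Finset.mul_sum, Real.exp_sum]
  refine Finset.prod_le_prod (fun _ _ => (Real.exp_pos _).le) fun m _ => ?_
  have h2 := Real.exp_pos (r * X ξ m)
  have h3 := Real.exp_pos (-r * X ξ m)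
  simp only [Fintype.sum_bool, if_true, Bool.false_eq_true, if_false]
  rcases abs_cases (X ξ m) with ⟨h4, _⟩ | ⟨h4, _⟩ <;> rw [h4]
  · linarith
  · rw [mul_neg, ← neg_mul]
    linarith

/-- For a product with `X_k`, half of the rate `δ` is reserved for the old polynomial. The other
half bounds `|x_k|` through `t + 1 ≤ exp t`. -/
theorem exists_abs_eval_le_exp (q : MvPolynomial (Fin n) ℝ) {δ : ℝ} (hδ : 0 < δ) :
    ∃ C : ℝ, 0 ≤ C ∧ ∀ x : Fin n → ℝ,
      |MvPolynomial.eval x q| ≤ C * Real.exp (δ * ∑ m, |x m|) := by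
  induction q using MvPolynomial.induction_on generalizing δ with
  | C a =>
    refine ⟨|a|, abs_nonneg a, fun x => ?_⟩
    rw [MvPolynomial.eval_C]
    refine le_mul_of_one_le_right (abs_nonneg a) (Real.one_le_exp ?_)
    exact mul_nonneg hδ.le (Finset.sum_nonneg fun _ _ => abs_nonneg _)
  | add q r hq hr =>
    obtain ⟨C, hC, h1⟩ := hq hδ
    obtain ⟨D, hD, h2⟩ := hr hδ
    refine ⟨C + D, add_nonneg hC hD, fun x => ?_⟩
    rw [map_add, add_mul]
    exact (abs_add_le _ _).trans (add_le_add (h1 x) (h2 x))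
  | mul_X q k hq =>
    obtain ⟨C, hC, h1⟩ := hq (half_pos hδ)
    refine ⟨C * (2 / δ), by positivity, fun x => ?_⟩
    have h2 : |x k| ≤ 2 / δ * Real.exp (δ / 2 * ∑ m, |x m|) := by
      have h3 : |x k| ≤ ∑ m, |x m| :=
        Finset.single_le_sum (f := fun m => |x m|) (fun _ _ => abs_nonneg _) (Finset.mem_univ k)
      have h4 := Real.add_one_le_exp (δ / 2 * ∑ m, |x m|)
      have h5 : δ / 2 * |x k| ≤ δ / 2 * ∑ m, |x m| := by gcongr
      calc |x k| = 2 / δ * (δ / 2 * |x k|) := by field_simp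
        _ ≤ _ := by
          refine mul_le_mul_of_nonneg_left ?_ (by positivity)
          linarith
    rw [map_mul, MvPolynomial.eval_X, abs_mul]
    calc |MvPolynomial.eval x q| * |x k|
        ≤ (C * Real.exp (δ / 2 * ∑ m, |x m|)) * (2 / δ * Real.exp (δ / 2 * ∑ m, |x m|)) :=
          mul_le_mul (h1 x) h2 (abs_nonneg _) (mul_nonneg hC (Real.exp_pos _).le)
      _ = C * (2 / δ) * Real.exp (δ / 2 * ∑ m, |x m| + δ / 2 * ∑ m, |x m|) := by
          rw [Real.exp_add]; ring
      _ = _ := by congr 2; ring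

theorem sum_mul_le_norm_mul_sum_abs (z x : Fin n → ℝ) : ∑ m, z m * x m ≤ ‖z‖ * ∑ m, |x m| := by
  rw [Finset.mul_sum]
  refine Finset.sum_le_sum fun m _ => (le_abs_self _).trans ?_
  rw [abs_mul]
  exact mul_le_mul_of_nonneg_right (norm_le_pi_norm z m) (abs_nonneg _)

/-- The exponentially weighted polynomial moment `E[q(X) exp⟨z, X⟩]`. -/
def expMoment (X : Ω → Fin n → ℝ) (P : Measure Ω) (q : MvPolynomial (Fin n) ℝ)
    (z : Fin n → ℝ) : ℝ :=
  ∫ ξ, MvPolynomial.eval (X ξ) q * Real.exp (∑ m, z m * X ξ m) ∂P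

theorem exists_integrable_bound {X : Ω → Fin n → ℝ} {r ρ : ℝ} (hρ : ρ < r)
    (h : Integrable (fun ξ => Real.exp (r * ∑ m, |X ξ m|)) P) (q : MvPolynomial (Fin n) ℝ) :
    ∃ b : Ω → ℝ, Integrable b P ∧ ∀ ξ, ∀ z : Fin n → ℝ, ‖z‖ ≤ ρ →
      ‖MvPolynomial.eval (X ξ) q * Real.exp (∑ m, z m * X ξ m)‖ ≤ b ξ := by
  obtain ⟨C, hC, hq⟩ := exists_abs_eval_le_exp q (sub_pos.2 hρ)
  refine ⟨_, h.const_mul C, fun ξ z hz => ?_⟩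
  rw [norm_mul, Real.norm_eq_abs, Real.norm_of_nonneg (Real.exp_pos _).le]
  have h1 : ∑ m, z m * X ξ m ≤ ρ * ∑ m, |X ξ m| :=
    (sum_mul_le_norm_mul_sum_abs z (X ξ)).trans
      (mul_le_mul_of_nonneg_right hz (Finset.sum_nonneg fun _ _ => abs_nonneg _))
  calc |MvPolynomial.eval (X ξ) q| * Real.exp (∑ m, z m * X ξ m)
      ≤ (C * Real.exp ((r - ρ) * ∑ m, |X ξ m|)) * Real.exp (ρ * ∑ m, |X ξ m|) :=
        mul_le_mul (hq _) (Real.exp_le_exp.2 h1) (Real.exp_pos _).le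
          (mul_nonneg hC (Real.exp_pos _).le)
    _ = C * Real.exp ((r - ρ) * ∑ m, |X ξ m| + ρ * ∑ m, |X ξ m|) := by
        rw [Real.exp_add]; ring
    _ = _ := by congr 2; ring

/-- Differentiation in `z_k` multiplies the weight `q` by `X_k`, so the family of weighted moments
is closed under derivatives. A radius `ρ` strictly between `‖z‖` and `r` leaves the margin `r - ρ`
that dominates the polynomial factor uniformly. -/
theorem hasFDerivAt_expMoment {X : Ω → Fin n → ℝ} (hX : Measurable X) {r : ℝ}
    (h : Integrable (fun ξ => Real.exp (r * ∑ m, |X ξ m|)) P) (q : MvPolynomial (Fin n) ℝ)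
    {z : Fin n → ℝ} (hz : z ∈ Metric.ball (0 : Fin n → ℝ) r) :
    HasFDerivAt (expMoment X P q)
      (∑ k, expMoment X P (q * MvPolynomial.X k) z •
        (ContinuousLinearMap.proj k : (Fin n → ℝ) →L[ℝ] ℝ)) z := by
  rw [mem_ball_zero_iff] at hz
  obtain ⟨ρ, hρ₁, hρ₂⟩ := exists_between hz
  have hmeas : ∀ (q : MvPolynomial (Fin n) ℝ) (z : Fin n → ℝ), AEStronglyMeasurable
      (fun ξ => MvPolynomial.eval (X ξ) q * Real.exp (∑ m, z m * X ξ m)) P := by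
    intro q z
    have h1 : Measurable fun ξ => MvPolynomial.eval (X ξ) q :=
      (MvPolynomial.continuous_eval q).measurable.comp hX
    exact (h1.mul (by fun_prop)).aestronglyMeasurable
  have hint : ∀ q : MvPolynomial (Fin n) ℝ, Integrable
      (fun ξ => MvPolynomial.eval (X ξ) q * Real.exp (∑ m, z m * X ξ m)) P := by
    intro q
    obtain ⟨b, hb, hb'⟩ := exists_integrable_bound hρ₂ h q
    exact hb.mono' (hmeas q z) (.of_forall fun ξ => hb' ξ z hρ₁.le)
  choose b hb hb' using fun k => exists_integrable_bound hρ₂ h (q * MvPolynomial.X k)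
  let pr : Fin n → (Fin n → ℝ) →L[ℝ] ℝ :=
    fun k => (ContinuousLinearMap.proj k : (Fin n → ℝ) →L[ℝ] ℝ)
  have key := hasFDerivAt_integral_of_dominated_of_fderiv_le (μ := P) (𝕜 := ℝ)
    (F := fun z ξ => MvPolynomial.eval (X ξ) q * Real.exp (∑ m, z m * X ξ m))
    (F' := fun z ξ => ∑ k, (MvPolynomial.eval (X ξ) (q * MvPolynomial.X k) *
      Real.exp (∑ m, z m * X ξ m)) • pr k)
    (bound := fun ξ => ∑ k, b k ξ * ‖pr k‖)
    (x₀ := z) (s := Metric.ball 0 ρ)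
    (Metric.isOpen_ball.mem_nhds (by rwa [mem_ball_zero_iff]))
    (.of_forall fun z => hmeas q z) (hint q) ?_ ?_ ?_ ?_
  · refine HasFDerivAt.congr_fderiv key ?_
    rw [integral_finsetSum _ fun k _ => (hint _).smul_const _]
    refine Finset.sum_congr rfl fun k _ => ?_
    rw [integral_smul_const]
    rfl
  · exact (integrable_finsetSum _ fun k _ =>
      (hint (q * MvPolynomial.X k)).smul_const (pr k)).aestronglyMeasurable
  · refine .of_forall fun ξ x hx => (norm_sum_le _ _).trans (Finset.sum_le_sum fun k _ => ?_)
    rw [norm_smul]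
    exact mul_le_mul_of_nonneg_right (hb' k ξ x (mem_ball_zero_iff.1 hx).le) (norm_nonneg _)
  · exact integrable_finsetSum _ fun k _ => (hb k).mul_const _
  · refine .of_forall fun ξ x _ => ?_
    have h1 : HasFDerivAt (fun x : Fin n → ℝ => ∑ m, x m * X ξ m) (∑ m, X ξ m • pr m) x := by
      refine HasFDerivAt.fun_sum fun m _ => ?_
      exact (hasFDerivAt_apply m x).mul_const (X ξ m)
    refine (h1.exp.const_mul (MvPolynomial.eval (X ξ) q)).congr_fderiv ?_
    rw [Finset.smul_sum, Finset.smul_sum]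
    refine Finset.sum_congr rfl fun m _ => ?_
    rw [smul_smul, smul_smul, map_mul, MvPolynomial.eval_X]
    congr 1
    ring

theorem contDiffOn_expMoment {X : Ω → Fin n → ℝ} (hX : Measurable X) {r : ℝ}
    (h : Integrable (fun ξ => Real.exp (r * ∑ m, |X ξ m|)) P) (q : MvPolynomial (Fin n) ℝ) :
    ContDiffOn ℝ ∞ (expMoment X P q) (Metric.ball 0 r) := by
  rw [contDiffOn_infty]
  intro N
  induction N generalizing q with
  | zero =>
    refine contDiffOn_zero.2 fun z hz => ?_
    exact (hasFDerivAt_expMoment hX h q hz).continuousAt.continuousWithinAt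
  | succ N ih =>
    push_cast
    rw [contDiffOn_succ_iff_fderiv_of_isOpen Metric.isOpen_ball]
    refine ⟨fun z hz => (hasFDerivAt_expMoment hX h q hz).differentiableAt.differentiableWithinAt,
      fun hN => absurd hN (by simp), ?_⟩
    refine ContDiffOn.congr (f := fun z => ∑ k, expMoment X P (q * MvPolynomial.X k) z •
      (ContinuousLinearMap.proj k : (Fin n → ℝ) →L[ℝ] ℝ)) ?_
      fun z hz => (hasFDerivAt_expMoment hX h q hz).fderiv
    exact ContDiffOn.sum fun k _ => (ih _).smul contDiffOn_const

theorem contDiffAt_jointCgf_zero [IsProbabilityMeasure P] {X : Ω → Fin n → ℝ} (hX : Measurable X)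
    (h : ∀ᶠ z in 𝓝 (0 : Fin n → ℝ), FiniteMGFAt X P z) :
    ContDiffAt ℝ ∞ (jointCgf X P) 0 := by
  obtain ⟨ε, hε, hball⟩ := Metric.eventually_nhds_iff_ball.1 h
  -- Halving `ε` puts the closed sup-norm ball, corners included, inside the open ball of
  -- finiteness.
  have hint := integrable_exp_mul_sum_abs (P := P) hX (r := ε / 2) fun z hz => hball z <| by
    rw [abs_of_pos (half_pos hε)] at hz
    rw [mem_ball_zero_iff]
    linarith
  have h1 : ContDiffAt ℝ ∞ (expMoment X P 1) 0 :=
    (contDiffOn_expMoment hX hint 1).contDiffAt (Metric.ball_mem_nhds _ (half_pos hε))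
  have h2 : jointCgf X P = fun z => Real.log (expMoment X P 1 z) := by
    ext z
    simp [jointCgf, expMoment]
  rw [h2]
  exact h1.log (by simp [expMoment])

theorem wordDeriv_comp_linear {h : ℝ → ℝ} (hh : AnalyticAt ℝ h 0) (a : Fin n → ℝ)
    (w : List (Fin n)) :
    wordDeriv w (fun z => h (∑ m, a m * z m)) =ᶠ[𝓝 0]
      fun z => (w.map a).prod * iteratedDeriv w.length h (∑ m, a m * z m) := by
  induction w with
  | nil => simp [wordDeriv]
  | cons k w ih =>
    refine (partialDeriv_eventuallyEq ih k).trans ?_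
    have hlin : Tendsto (fun z : Fin n → ℝ => ∑ m, a m * z m) (𝓝 0) (𝓝 0) := by
      have : Continuous fun z : Fin n → ℝ => ∑ m, a m * z m := by fun_prop
      simpa using this.tendsto 0
    have han : AnalyticAt ℝ (iteratedDeriv w.length h) 0 := by
      rw [iteratedDeriv_eq_iterate]
      exact hh.iterated_deriv _
    filter_upwards [hlin.eventually han.eventually_analyticAt] with z hz
    have h1 : HasLineDerivAt ℝ (fun z : Fin n → ℝ => ∑ m, a m * z m) (a k) z (Pi.single k 1) := by
      have h2 : HasFDerivAt (fun z : Fin n → ℝ => ∑ m, a m * z m)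
          (∑ m, a m • (ContinuousLinearMap.proj m : (Fin n → ℝ) →L[ℝ] ℝ)) z :=
        HasFDerivAt.fun_sum fun m _ => (hasFDerivAt_apply m z).const_mul (a m)
      have h3 := h2.hasLineDerivAt (Pi.single k 1)
      simpa [Pi.single_apply] using h3
    have h3 : HasDerivAt (iteratedDeriv w.length h) (iteratedDeriv (w.length + 1) h
        (∑ m, a m * z m)) (∑ m, a m * z m) := by
      rw [iteratedDeriv_succ]
      exact hz.differentiableAt.hasDerivAt
    have h4 : HasLineDerivAt ℝ (fun z : Fin n → ℝ => (w.map a).prod *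
        iteratedDeriv w.length h (∑ m, a m * z m))
        ((w.map a).prod * (iteratedDeriv (w.length + 1) h (∑ m, a m * z m) * a k)) z
        (Pi.single k 1) := by
      have h3' : HasDerivAt (iteratedDeriv w.length h) (iteratedDeriv (w.length + 1) h
          (∑ m, a m * z m)) (∑ m, a m * (z + (0 : ℝ) • (Pi.single k 1 : Fin n → ℝ)) m) := by
        simpa using h3
      exact (HasDerivAt.comp (0 : ℝ) h3' h1).const_mul _
    rw [partialDeriv, h4.lineDeriv, List.map_cons, List.prod_cons, List.length_cons]
    ring

theorem mixedPartial_comp_linear {h : ℝ → ℝ} (hh : AnalyticAt ℝ h 0) (a : Fin n → ℝ)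
    (l : Fin n →₀ ℕ) :
    mixedPartial l (fun z => h (∑ m, a m * z m)) 0 =
      iteratedDeriv l.degree h 0 * ∏ m, a m ^ l m := by
  rw [mixedPartial_eq_wordDeriv, (wordDeriv_comp_linear hh a _).eq_of_nhds,
    length_multiIndexWord, mul_comm]
  congr 1
  · simp
  · rw [multiIndexWord, List.map_flatMap, List.flatMap_def, List.prod_flatten, List.map_map]
    simp [← List.prod_ofFn, List.ofFn_eq_map, Function.comp_def]

end Smoothness

/-! ### Exponential moments of Lévy processes and conditioning on the subordinator -/

section Levy

open scoped ENNReal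

variable {Ω : Type*} [MeasurableSpace Ω] {P : Measure Ω}

/-! ### Exponential moments of a Lévy process -/

/-- The moment generating function of `X t` at `u`, with values in `[0, ∞]`. -/
def lexpMoment (X : ℝ≥0 → Ω → ℝ) (P : Measure Ω) (u : ℝ) (t : ℝ≥0) : ℝ≥0∞ :=
  ∫⁻ ω, ENNReal.ofReal (Real.exp (u * X t ω)) ∂P

/-- Independence and stationarity of increments give multiplicativity in time. With values in `[0,
∞]` no integrability is needed, so finiteness at other times can be deduced from it. -/
theorem lexpMoment_add {X : ℝ≥0 → Ω → ℝ} (hX : IsLevyProcess X P) (u : ℝ) (s t : ℝ≥0) :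
    lexpMoment X P u (s + t) = lexpMoment X P u s * lexpMoment X P u t := by
  have hφ : Measurable fun x : ℝ => ENNReal.ofReal (Real.exp (u * x)) := by fun_prop
  have hind : IndepFun (X s) (X (s + t) - X s) P :=
    hX.indep_increments.indepFun_eval_sub (zero_le) (le_self_add) hX.start_zero
  have h1 := lintegral_mul_eq_lintegral_mul_lintegral_of_indepFun
    (hφ.comp (hX.measurable s)) (hφ.comp ((hX.measurable (s + t)).sub (hX.measurable s)))
    (hind.comp hφ hφ)
  have h2 : ∫⁻ ω, ENNReal.ofReal (Real.exp (u * (X (s + t) - X s) ω)) ∂P =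
      lexpMoment X P u t := by
    have h3 := ((hX.stationary_increments s t).comp hφ).lintegral_eq
    refine h3.trans (lintegral_congr_ae ?_)
    filter_upwards [hX.start_zero] with ω hω
    simp [hω]
  refine Eq.trans ?_ (h1.trans (congrArg _ h2))
  refine lintegral_congr fun ω => ?_
  simp only [Pi.mul_apply, Function.comp_apply, Pi.sub_apply]
  rw [← ENNReal.ofReal_mul (Real.exp_pos _).le, ← Real.exp_add]
  congr 2
  ring

theorem lexpMoment_natCast_mul [IsProbabilityMeasure P] {X : ℝ≥0 → Ω → ℝ} (hX : IsLevyProcess X P)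
    (u : ℝ) (t : ℝ≥0) (j : ℕ) :
    lexpMoment X P u (j * t) = lexpMoment X P u t ^ j := by
  induction j with
  | zero =>
    have : ∀ᵐ ω ∂P, ENNReal.ofReal (Real.exp (u * X 0 ω)) = 1 := by
      filter_upwards [hX.start_zero] with ω hω
      simp [hω]
    simp [lexpMoment, lintegral_congr_ae this]
  | succ j ih =>
    rw [Nat.cast_succ, add_mul, one_mul, lexpMoment_add hX, ih, pow_succ]

/-- The point `(j + 1) / (N + 1)`. For `j = ⌊(N + 1) t⌋` it approximates `t` from the right. -/
def gridPoint (N : ℕ) (j : ℕ) : ℝ≥0 := (j + 1) / (N + 1)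

theorem tendsto_gridPoint (t : ℝ≥0) :
    Tendsto (fun N : ℕ => gridPoint N ⌊(N + 1) * t⌋₊) atTop (𝓝[≥] t) := by
  have hle : ∀ N : ℕ, t ≤ gridPoint N ⌊(N + 1) * t⌋₊ := by
    intro N
    rw [gridPoint, le_div_iff₀ (by positivity), mul_comm]
    exact (Nat.lt_floor_add_one _).le
  have hge : ∀ N : ℕ, gridPoint N ⌊(N + 1) * t⌋₊ ≤ t + 1 / ((N : ℝ≥0) + 1) := by
    intro N
    have hN : (N : ℝ≥0) + 1 ≠ 0 := by positivity
    rw [gridPoint, div_le_iff₀ (by positivity), add_mul t, one_div, inv_mul_cancel₀ hN, mul_comm t]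
    gcongr
    exact Nat.floor_le zero_le
  refine tendsto_nhdsWithin_iff.2 ⟨?_, .of_forall hle⟩
  refine tendsto_of_tendsto_of_tendsto_of_le_of_le tendsto_const_nhds ?_ hle hge
  simpa using (tendsto_const_nhds (x := t)).add
    (tendsto_one_div_add_atTop_nhds_zero_nat (𝕜 := ℝ≥0))

/-- The moment at time `1 / (N + 1)` is the unique `(N + 1)`-th root in `[0, ∞]` of the moment at
time `1`; the grid times follow by taking powers. -/
theorem lexpMoment_gridPoint [IsProbabilityMeasure P] {X : ℝ≥0 → Ω → ℝ}
    (hX : IsLevyProcess X P) {u : ℝ} (hu : Integrable (fun ω => Real.exp (u * X 1 ω)) P)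
    (N j : ℕ) :
    lexpMoment X P u (gridPoint N j) =
      ENNReal.ofReal (Real.exp (gridPoint N j * cgf (X 1) P u)) := by
  have h1 : lexpMoment X P u 1 = ENNReal.ofReal (Real.exp (cgf (X 1) P u)) := by
    rw [exp_cgf hu, mgf, ofReal_integral_eq_lintegral_ofReal hu
      (.of_forall fun _ => (Real.exp_pos _).le)]
    rfl
  set v : ℝ≥0 := 1 / (N + 1) with hv
  have hroot : lexpMoment X P u v = ENNReal.ofReal (Real.exp (v * cgf (X 1) P u)) := by
    have h2 := lexpMoment_natCast_mul hX u v (N + 1)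
    have h3 : ((N + 1 : ℕ) : ℝ≥0) * v = 1 := by
      rw [hv]; push_cast; field_simp
    rw [h3, h1] at h2
    refine ((ENNReal.pow_right_strictMono (Nat.succ_ne_zero N)).injective ?_)
    change _ ^ (N + 1) = _ ^ (N + 1)
    rw [← h2, ← ENNReal.ofReal_pow (Real.exp_pos _).le, ← Real.exp_nat_mul, ← mul_assoc]
    have h5 : ((N + 1 : ℕ) : ℝ) * (v : ℝ) = 1 := by exact_mod_cast congrArg NNReal.toReal h3
    rw [h5, one_mul]
  have h4 : gridPoint N j = (j + 1 : ℕ) * v := by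
    rw [gridPoint, hv]; push_cast; field_simp
  rw [h4, lexpMoment_natCast_mul hX, hroot, ← ENNReal.ofReal_pow (Real.exp_pos _).le,
    ← Real.exp_nat_mul]
  congr 2
  push_cast
  ring

/-- Right-continuity of paths and Fatou's lemma along grid times decreasing to within `1 / (N + 1)`
of `t`. Only an inequality results, as no domination is available. -/
theorem lexpMoment_le [IsProbabilityMeasure P] {X : ℝ≥0 → Ω → ℝ}
    (hX : IsLevyProcess X P) {u : ℝ} (hu : Integrable (fun ω => Real.exp (u * X 1 ω)) P)
    (t : ℝ≥0) :
    lexpMoment X P u t ≤ ENNReal.ofReal (Real.exp (t * cgf (X 1) P u)) := by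
  have hlim : ∀ᵐ ω ∂P, Tendsto (fun N : ℕ => ENNReal.ofReal
      (Real.exp (u * X (gridPoint N ⌊(N + 1) * t⌋₊) ω))) atTop
      (𝓝 (ENNReal.ofReal (Real.exp (u * X t ω)))) := by
    filter_upwards [hX.cadlag] with ω hω
    have h1 := ((hω t).1.tendsto.comp (tendsto_gridPoint t)).const_mul u
    exact ENNReal.tendsto_ofReal ((Real.continuous_exp.tendsto _).comp h1)
  have hlim' : Tendsto (fun N : ℕ => lexpMoment X P u (gridPoint N ⌊(N + 1) * t⌋₊)) atTop
      (𝓝 (ENNReal.ofReal (Real.exp (t * cgf (X 1) P u)))) := by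
    simp only [lexpMoment_gridPoint hX hu]
    refine ENNReal.tendsto_ofReal ((Real.continuous_exp.tendsto _).comp (Tendsto.mul_const _ ?_))
    exact (NNReal.continuous_coe.tendsto t).comp
      ((tendsto_gridPoint t).mono_right nhdsWithin_le_nhds)
  calc lexpMoment X P u t = ∫⁻ ω, liminf (fun N : ℕ => ENNReal.ofReal
      (Real.exp (u * X (gridPoint N ⌊(N + 1) * t⌋₊) ω))) atTop ∂P :=
        lintegral_congr_ae (hlim.mono fun ω hω => hω.liminf_eq.symm)
    _ ≤ liminf (fun N : ℕ => lexpMoment X P u (gridPoint N ⌊(N + 1) * t⌋₊)) atTop :=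
        lintegral_liminf_le fun N => by
          have := hX.measurable (gridPoint N ⌊(N + 1) * t⌋₊)
          fun_prop
    _ = _ := hlim'.liminf_eq

theorem lexpMoment_eq [IsProbabilityMeasure P] {X : ℝ≥0 → Ω → ℝ}
    (hX : IsLevyProcess X P) {u : ℝ} (hu : Integrable (fun ω => Real.exp (u * X 1 ω)) P)
    (t : ℝ≥0) :
    lexpMoment X P u t = ENNReal.ofReal (Real.exp (t * cgf (X 1) P u)) := by
  refine le_antisymm (lexpMoment_le hX hu t) ?_
  set κ := cgf (X 1) P u
  -- Reverse inequality: with `t + r = j + 1` an integer time, `exp((t + r) κ) = M(t) M(r) ≤ M(t)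
  -- exp(r κ)`, where `M` is the moment at `u`. The finite positive factor `exp(r κ)` cancels.
  obtain ⟨j, hj⟩ := exists_nat_ge t
  have hj' : t ≤ gridPoint 0 j := by
    rw [gridPoint]
    simpa using hj.trans (le_self_add)
  set r := gridPoint 0 j - t with hr
  have hsum : t + r = gridPoint 0 j := add_tsub_cancel_of_le hj'
  have h1 := lexpMoment_add hX u t r
  rw [hsum, lexpMoment_gridPoint hX hu, ← hsum, NNReal.coe_add, add_mul, Real.exp_add,
    ENNReal.ofReal_mul (Real.exp_pos _).le] at h1
  have h2 := mul_le_mul_right (lexpMoment_le hX hu r) (lexpMoment X P u t)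
  rw [← h1] at h2
  exact (ENNReal.mul_le_mul_iff_left (by simp [Real.exp_pos]) ENNReal.ofReal_ne_top).1 h2

/-! ### Subordination -/

variable {n d : ℕ}

theorem tendsto_sum_mul_gridPoint (u : Fin d → ℝ) {x : Fin d → ℝ≥0 → ℝ}
    (hx : ∀ k t, ContinuousWithinAt (x k) (Set.Ici t) t) (t : Fin d → ℝ≥0) :
    Tendsto (fun N : ℕ => ENNReal.ofReal
      (Real.exp (∑ k, u k * x k (gridPoint N ⌊(N + 1) * t k⌋₊)))) atTop
      (𝓝 (ENNReal.ofReal (Real.exp (∑ k, u k * x k (t k))))) := by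
  refine ENNReal.tendsto_ofReal ((Real.continuous_exp.tendsto _).comp ?_)
  exact tendsto_finsetSum _ fun k _ =>
    ((hx k (t k)).tendsto.comp (tendsto_gridPoint (t k))).const_mul (u k)

/-- Evaluation at a variable time is a problem for the product σ-algebra on paths. Here the time
enters through countably many grid indices, and for fixed indices only `d` path coordinates are
read. -/
theorem measurable_sum_mul_gridPoint (u : Fin d → ℝ) (N : ℕ) :
    Measurable fun y : (Fin d → ℝ≥0 → ℝ) × (Fin d → ℝ≥0) => ENNReal.ofReal
      (Real.exp (∑ k, u k * y.1 k (gridPoint N ⌊(N + 1) * y.2 k⌋₊))) := by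
  have h1 : Measurable fun y : (Fin d → ℝ≥0 → ℝ) × (Fin d → ℕ) => ENNReal.ofReal
      (Real.exp (∑ k, u k * y.1 k (gridPoint N (y.2 k)))) := by
    refine measurable_from_prod_countable_left fun j => ?_
    dsimp only
    fun_prop
  have h2 : Measurable fun y : (Fin d → ℝ≥0 → ℝ) × (Fin d → ℝ≥0) =>
      (y.1, fun k => ⌊((N : ℝ≥0) + 1) * y.2 k⌋₊) := by
    refine measurable_fst.prodMk (measurable_pi_lambda _ fun k => ?_)
    exact Nat.measurable_floor.comp (by fun_prop)
  exact h1.comp h2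

theorem lintegral_exp_sum_eq_prod [IsProbabilityMeasure P] {Z : Fin d → ℝ≥0 → Ω → ℝ}
    (hZ : ∀ k, IsLevyProcess (Z k) P) (hind : iIndepFun (fun k ω t => Z k t ω) P) {u : Fin d → ℝ}
    (hu : ∀ k, Integrable (fun ω => Real.exp (u k * Z k 1 ω)) P) (t : Fin d → ℝ≥0) :
    ∫⁻ ω, ENNReal.ofReal (Real.exp (∑ k, u k * Z k (t k) ω)) ∂P =
      ENNReal.ofReal (Real.exp (∑ k, t k * cgf (Z k 1) P (u k))) := by
  have hφ : ∀ k, Measurable fun x : ℝ≥0 → ℝ => ENNReal.ofReal (Real.exp (u k * x (t k))) := by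
    intro k
    fun_prop
  have h1 := lintegral_prod_eq_prod_lintegral_of_indepFun Finset.univ _ (hind.comp _ hφ)
    (fun k => (hφ k).comp (measurable_pi_lambda _ fun t => (hZ k).measurable t))
  simp only [Function.comp_apply] at h1
  have h2 : ∀ k, ∫⁻ ω, ENNReal.ofReal (Real.exp (u k * Z k (t k) ω)) ∂P =
      ENNReal.ofReal (Real.exp (t k * cgf (Z k 1) P (u k))) := fun k => lexpMoment_eq (hZ k) (hu k) _
  simp only [h2] at h1
  rw [Real.exp_sum, ENNReal.ofReal_prod_of_nonneg fun _ _ => (Real.exp_pos _).le, ← h1]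
  refine lintegral_congr fun ω => ?_
  rw [Real.exp_sum, ENNReal.ofReal_prod_of_nonneg fun _ _ => (Real.exp_pos _).le]

/-- Conditioning on `τ`: independence makes the joint law of paths and times a product, and Tonelli
reduces the claim to deterministic times. -/
theorem aemeasurable_and_lintegral_exp_subordinated [IsProbabilityMeasure P]
    {Z : Fin d → ℝ≥0 → Ω → ℝ} (hZ : ∀ k, IsLevyProcess (Z k) P)
    (hind : iIndepFun (fun k ω t => Z k t ω) P) {τ : Ω → Fin d → ℝ≥0} (hτ : Measurable τ)
    (hZτ : IndepFun (fun ω k t => Z k t ω) τ P) {u : Fin d → ℝ}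
    (hu : ∀ k, Integrable (fun ω => Real.exp (u k * Z k 1 ω)) P) :
    AEMeasurable (fun ω => ENNReal.ofReal (Real.exp (∑ k, u k * Z k (τ ω k) ω))) P ∧
    ∫⁻ ω, ENNReal.ofReal (Real.exp (∑ k, u k * Z k (τ ω k) ω)) ∂P =
      ∫⁻ ω, ENNReal.ofReal (Real.exp (∑ k, τ ω k * cgf (Z k 1) P (u k))) ∂P := by
  set W : Ω → Fin d → ℝ≥0 → ℝ := fun ω k t => Z k t ω
  have hWm : Measurable W :=
    measurable_pi_lambda _ fun k => measurable_pi_lambda _ fun t => (hZ k).measurable t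
  have hcad : ∀ᵐ ω ∂P, ∀ k t, ContinuousWithinAt (W ω k) (Set.Ici t) t :=
    ae_all_iff.2 fun k => (hZ k).cadlag.mono fun ω hω t => (hω t).1
  -- `G` is a measurable substitute for evaluating the paths at the given times, correct whenever
  -- the paths are right-continuous.
  let G : (Fin d → ℝ≥0 → ℝ) × (Fin d → ℝ≥0) → ℝ≥0∞ := fun y =>
    limsup (fun N : ℕ => ENNReal.ofReal
      (Real.exp (∑ k, u k * y.1 k (gridPoint N ⌊(N + 1) * y.2 k⌋₊)))) atTop
  have hG : Measurable G := .limsup fun N => measurable_sum_mul_gridPoint u N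
  -- The null set does not depend on `t`, so the random time `τ ω` may be inserted as well as a
  -- fixed one.
  have hGW : ∀ᵐ ω ∂P, ∀ t : Fin d → ℝ≥0,
      G (W ω, t) = ENNReal.ofReal (Real.exp (∑ k, u k * Z k (t k) ω)) :=
    hcad.mono fun ω hω t => (tendsto_sum_mul_gridPoint u hω t).limsup_eq
  have hGWτ : (fun ω => ENNReal.ofReal (Real.exp (∑ k, u k * Z k (τ ω k) ω))) =ᵐ[P]
      fun ω => G (W ω, τ ω) := hGW.mono fun ω hω => (hω (τ ω)).symm
  refine ⟨(hG.comp (hWm.prodMk hτ)).aemeasurable.congr hGWτ.symm, ?_⟩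
  have hmap := (indepFun_iff_map_prod_eq_prod_map_map hWm.aemeasurable hτ.aemeasurable).1 hZτ
  have : IsProbabilityMeasure (P.map W) := Measure.isProbabilityMeasure_map hWm.aemeasurable
  have : IsProbabilityMeasure (P.map τ) := Measure.isProbabilityMeasure_map hτ.aemeasurable
  calc ∫⁻ ω, ENNReal.ofReal (Real.exp (∑ k, u k * Z k (τ ω k) ω)) ∂P
      = ∫⁻ ω, G (W ω, τ ω) ∂P := lintegral_congr_ae hGWτ
    _ = ∫⁻ y, G y ∂(P.map fun ω => (W ω, τ ω)) := (lintegral_map hG (hWm.prodMk hτ)).symm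
    _ = ∫⁻ t, ∫⁻ w, G (w, t) ∂(P.map W) ∂(P.map τ) := by
        rw [hmap, lintegral_prod_symm' _ hG]
    _ = ∫⁻ ω, ∫⁻ w, G (w, τ ω) ∂(P.map W) ∂P :=
        lintegral_map hG.lintegral_prod_left' hτ
    _ = ∫⁻ ω, ENNReal.ofReal (Real.exp (∑ k, τ ω k * cgf (Z k 1) P (u k))) ∂P := by
        refine lintegral_congr fun ω => ?_
        rw [lintegral_map (f := fun w => G (w, τ ω)) (hG.comp (by fun_prop)) hWm,
          ← lintegral_exp_sum_eq_prod hZ hind hu]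
        exact lintegral_congr_ae (hGW.mono fun ω' hω' => hω' (τ ω))

theorem IsSubordinator.ae_nonneg {T : ℝ≥0 → Ω → (Fin d → ℝ)} (hT : IsSubordinator T P)
    (t : ℝ≥0) : ∀ᵐ ω ∂P, ∀ k, 0 ≤ T t ω k := by
  filter_upwards [hT.isLevy.start_zero, hT.increasing] with ω h0 h1 k
  have := h1 k (zero_le (a := t))
  simpa [h0] using this

theorem finiteMGFAt_and_jointCgf_subordinated [IsProbabilityMeasure P]
    (A : Matrix (Fin n) (Fin d) ℝ)
    {Z : Fin d → ℝ≥0 → Ω → ℝ} {T : ℝ≥0 → Ω → (Fin d → ℝ)} (hZ : ∀ k, IsLevyProcess (Z k) P)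
    (hind : iIndepFun (fun k ω t => Z k t ω) P) (hT : IsSubordinator T P)
    (hZT : IndepFun (fun ω k t => Z k t ω) (fun ω t => T t ω) P) (z : Fin n → ℝ)
    (hu : ∀ k, Integrable (fun ω => Real.exp ((∑ m, A m k * z m) * Z k 1 ω)) P)
    (hfin : FiniteMGFAt (T 1) P (fun k => cgf (Z k 1) P (∑ m, A m k * z m))) :
    FiniteMGFAt (subordinated A Z T 1) P z ∧
      jointCgf (subordinated A Z T 1) P z =
        jointCgf (T 1) P (fun k => cgf (Z k 1) P (∑ m, A m k * z m)) := by
  set u : Fin d → ℝ := fun k => ∑ m, A m k * z m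
  set τ : Ω → Fin d → ℝ≥0 := fun ω k => (T 1 ω k).toNNReal
  have hφ : Measurable fun (x : ℝ≥0 → Fin d → ℝ) (k : Fin d) => (x 1 k).toNNReal := by fun_prop
  have hτ : Measurable τ := hφ.comp (measurable_pi_lambda _ fun t => hT.isLevy.measurable t)
  obtain ⟨hmeas, heq⟩ := aemeasurable_and_lintegral_exp_subordinated hZ hind hτ
    (hZT.comp measurable_id hφ) hu
  have hsum : ∀ ω, ∑ m, z m * subordinated A Z T 1 ω m = ∑ k, u k * Z k (τ ω k) ω := by
    intro ω
    simp only [subordinated, Matrix.mulVec, dotProduct, Finset.mul_sum, u, Finset.sum_mul]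
    rw [Finset.sum_comm]
    refine Finset.sum_congr rfl fun k _ => Finset.sum_congr rfl fun m _ => ?_
    ring
  -- Almost surely `T(1)` lies in the nonnegative orthant, so `Real.toNNReal` truncates nothing.
  have hTeq : ∫⁻ ω, ENNReal.ofReal (Real.exp (∑ k, τ ω k * cgf (Z k 1) P (u k))) ∂P =
      ∫⁻ ω, ENNReal.ofReal (Real.exp (∑ k, cgf (Z k 1) P (u k) * T 1 ω k)) ∂P := by
    refine lintegral_congr_ae ?_
    filter_upwards [hT.ae_nonneg 1] with ω hω
    simp only [τ, Real.coe_toNNReal _ (hω _), mul_comm]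
  rw [hTeq] at heq
  have hmeas' : AEMeasurable (fun ω => Real.exp (∑ k, u k * Z k (τ ω k) ω)) P :=
    hmeas.ennreal_toReal.congr (.of_forall fun ω => ENNReal.toReal_ofReal (Real.exp_pos _).le)
  have hfin' : ∫⁻ ω, ENNReal.ofReal (Real.exp (∑ k, cgf (Z k 1) P (u k) * T 1 ω k)) ∂P ≠ ∞ :=
    (lintegral_ofReal_ne_top_iff_integrable hfin.aestronglyMeasurable
      (.of_forall fun _ => (Real.exp_pos _).le)).2 hfin
  constructor
  · unfold FiniteMGFAt
    simp only [hsum]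
    refine (lintegral_ofReal_ne_top_iff_integrable hmeas'.aestronglyMeasurable
      (.of_forall fun _ => (Real.exp_pos _).le)).1 ?_
    rwa [heq]
  · unfold jointCgf
    simp only [hsum]
    rw [integral_eq_lintegral_of_nonneg_ae (.of_forall fun _ => (Real.exp_pos _).le)
      hmeas'.aestronglyMeasurable,
      integral_eq_lintegral_of_nonneg_ae (.of_forall fun _ => (Real.exp_pos _).le)
      hfin.aestronglyMeasurable, heq]

end Levy

end SubLevy

end

/-! ### Assembly of the three claims -/

open SubLevy in
theorem theorem1 {Ω : Type*} [MeasurableSpace Ω] (P : Measure Ω) [IsProbabilityMeasure P]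
    (n d : ℕ) (A : Matrix (Fin n) (Fin d) ℝ)
    (Z : Fin d → ℝ≥0 → Ω → ℝ) (T : ℝ≥0 → Ω → (Fin d → ℝ))
    -- the components of `Z` are independent Lévy processes
    (hZ : ∀ k, SubLevy.IsLevyProcess (Z k) P)
    (hZindep : iIndepFun (fun k ω t => Z k t ω) P)
    -- `T` is a subordinator independent of `Z`
    (hT : SubLevy.IsSubordinator T P)
    (hZT : IndepFun (fun ω k t => Z k t ω) (fun ω t => T t ω) P)
    -- `Z_k(1)` and `T(1)` have a moment generating function near the origin
    (hZmgf : ∀ k, ∀ᶠ u in 𝓝 (0 : ℝ), Integrable (fun ω => Real.exp (u * Z k 1 ω)) P)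
    (hTmgf : ∀ᶠ z in 𝓝 (0 : Fin d → ℝ), SubLevy.FiniteMGFAt (T 1) P z) :
    -- so has `Y(1)`
    (∀ᶠ z in 𝓝 (0 : Fin n → ℝ), SubLevy.FiniteMGFAt (SubLevy.subordinated A Z T 1) P z) ∧
    -- `K_Y` is the composed cumulant generating function wherever the latter is defined
    (∀ z : Fin n → ℝ,
      (∀ k, Integrable (fun ω => Real.exp ((∑ m, A m k * z m) * Z k 1 ω)) P) →
      SubLevy.FiniteMGFAt (T 1) P (fun k => cgf (Z k 1) P (∑ m, A m k * z m)) →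
      SubLevy.FiniteMGFAt (SubLevy.subordinated A Z T 1) P z ∧
      SubLevy.jointCgf (SubLevy.subordinated A Z T 1) P z =
        SubLevy.jointCgf (T 1) P (fun k => cgf (Z k 1) P (∑ m, A m k * z m))) ∧
    -- the joint cumulants of `Y(1)`
    (∀ i : Fin n →₀ ℕ,
      SubLevy.jointCumulant (SubLevy.subordinated A Z T 1) P i =
        SubLevy.umbralEval (T 1) P
          (SubLevy.bellPolynomial (SubLevy.cumulantSeq A (fun k => Z k 1) P) i)) := by
  have hmain := finiteMGFAt_and_jointCgf_subordinated A hZ hZindep hT hZT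
  have hcgf : ∀ k, AnalyticAt ℝ (cgf (Z k 1) P) 0 := fun k =>
    analyticAt_cgf (mem_interior_iff_mem_nhds.2 (hZmgf k))
  let g : (Fin n → ℝ) → (Fin d → ℝ) := fun z k => cgf (Z k 1) P (∑ m, A m k * z m)
  have hg0 : g 0 = 0 := by
    ext k
    simp [g]
  have hg : ContDiffAt ℝ (⊤ : ℕ∞) g 0 := by
    refine contDiffAt_pi.2 fun k => ?_
    have h1 : ContDiffAt ℝ (⊤ : ℕ∞) (fun z : Fin n → ℝ => ∑ m, A m k * z m) 0 := by fun_prop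
    have h2 : ContDiffAt ℝ (⊤ : ℕ∞) (cgf (Z k 1) P) (∑ m, A m k * (0 : Fin n → ℝ) m) := by
      simpa using (hcgf k).contDiffAt
    exact ContDiffAt.comp (g := cgf (Z k 1) P) 0 h2 h1
  have hlin : ∀ k, Tendsto (fun z : Fin n → ℝ => ∑ m, A m k * z m) (𝓝 0) (𝓝 0) := by
    intro k
    have : Continuous fun z : Fin n → ℝ => ∑ m, A m k * z m := by fun_prop
    simpa using this.tendsto 0
  -- Both `z ↦ Aᵀ z` and `g` are continuous at `0` and vanish there, so the finiteness hypotheses on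
  -- `Z_k(1)` and `T(1)` pull back to a neighbourhood of `0`.
  have hev : ∀ᶠ z in 𝓝 (0 : Fin n → ℝ),
      (∀ k, Integrable (fun ω => Real.exp ((∑ m, A m k * z m) * Z k 1 ω)) P) ∧
      FiniteMGFAt (T 1) P (g z) := by
    refine (eventually_all.2 fun k => (hlin k).eventually (hZmgf k)).and ?_
    have := hg.continuousAt.tendsto
    rw [hg0] at this
    exact this.eventually hTmgf
  refine ⟨hev.mono fun z hz => (hmain z hz.1 hz.2).1, hmain, fun i => ?_⟩
  -- Derivatives at `0` depend only on the germ, so the identity near the origin suffices.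
  have hK : jointCgf (subordinated A Z T 1) P =ᶠ[𝓝 0] jointCgf (T 1) P ∘ g :=
    hev.mono fun z hz => (hmain z hz.1 hz.2).2
  have hseq : cumulantSeq A (fun k => Z k 1) P =
      fun k l => mixedPartial l (fun z => g z k) 0 := by
    funext k l
    exact (mixedPartial_comp_linear (hcgf k) (fun m => A m k) l).symm
  rw [jointCumulant, mixedPartial_congr hK i, hseq]
  exact mixedPartial_comp_eq_constr_bellPolynomial
    (contDiffAt_jointCgf_zero (hT.isLevy.measurable 1) hTmgf) hg hg0 i
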